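/- Consider the class of second-order evolution equations $u_t=H(t,x,u,u_x,u_{xx})$, where the arbitrary element $H$ is a smooth function on an open set with $H_{u_{xx}}\ne0$ everywhere on it. All transformations are smooth and local (considered near a point of the second-order jet space with the coordinates $(t,x,u,u_t,u_x,u_{tt},u_{tx},u_{xx})$ at which their second prolongation is defined). A contact transformation is a local diffeomorphism of the space of first-order jets $(t,x,u,u_t,u_x)$ that multiplies the form $du-u_t\,dt-u_x\,dx$ by a nonvanishing function. A contact admissible transformation of the class is a triple $(H,\tilde H,\Phi)$, where $\Phi$ is a contact transformation whose second prolongation maps the manifold $u_t=H$ to the manifold $\tilde u_{\tilde t}=\tilde H$. The contact equivalence group $G^\sim_{\rm c}$ of the class is the (pseudo)group of nondegenerate transformations $\Psi$ of the space of variables $(t,x,u,u_t,u_x,u_{tt},u_{tx},u_{xx},H)$ that project to a contact transformation $\Phi$ and to its second prolongation and map the class onto itself in such a way that $(H,\Psi H,\Phi)$ is a contact admissible transformation for every $H$ from the class; locally, $\Psi$ is considered near points with $H=u_t$. (i) The class is normalized with respect to contact transformations: for every contact admissible transformation $(H,\tilde H,\Phi)$ there is $\Psi\in G^\sim_{\rm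 c}$ that projects to $\Phi$ and satisfies $\tilde H=\Psi H$. (ii) The contact equivalence group $G^\sim_{\rm c}$ consists exactly of the transformations \[ \tilde t=T(t),\quad \tilde x=X(t,x,u,u_x),\quad \tilde u=U(t,x,u,u_x),\quad \tilde H=\frac{U_u-X_uV}{T_t}H+\frac{U_t-X_tV}{T_t}, \] where the smooth functions $T$, $X$ and $U$ satisfy the nondegeneracy conditions \[ T_t\ne0,\qquad \operatorname{rank}\begin{pmatrix}X_x&X_u&X_{u_x}\\U_x&U_u&U_{u_x}\end{pmatrix}=2 \] and the contact condition \[ (U_x+U_uu_x)X_{u_x}=(X_x+X_uu_x)U_{u_x}, \] at points where $D_xX:=X_x+X_uu_x+X_{u_x}u_{xx}\ne0$. Here $V=\dfrac{U_x+U_uu_x}{X_x+X_uu_x}$ if $X_x+X_uu_x\ne0$ and $V=\dfrac{U_{u_x}}{X_{u_x}}$ if $X_{u_x}\ne0$ (the two expressions agree if both are defined), and the transformation is uniquely prolonged to derivatives, with \[ \tilde u_{\tilde x}=V,\qquad \tilde u_{\tilde t}=\frac{U_u-X_uV}{T_t}u_t+\frac{U_t-X_tV}{T_t},\qquad \tilde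 u_{\tilde x\tilde x}=\frac{D_xV}{D_xX}, \] where $D_xV:=V_x+V_uu_x+V_{u_x}u_{xx}$. In particular, every contact transformation $\Phi$ between two equations of the class with right-hand sides $H$ and $\tilde H$ is of this form, and $\tilde H(\tilde t,\tilde x,\tilde u,\tilde u_{\tilde x},\tilde u_{\tilde x\tilde x})$ is given in terms of $H(t,x,u,u_x,u_{xx})$ by the above formula. -/

import Mathlib

open scoped ContDiff Topology

noncomputable section

namespace EvolContact

/-! Jet coordinates.  All objects are local: transformations and equations are
considered near a given point of the second-order jet space. -/

/-- First-order jets `(t, x, u, u_t, u_x)`. -/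
abbrev J1 : Type := Fin 5 → ℝ

/-- Second-order jets `(t, x, u, u_t, u_x, u_tt, u_tx, u_xx)`. -/
abbrev J2 : Type := Fin 8 → ℝ

/-- The arguments `(t, x, u, u_x)` of `X` and `U`. -/
abbrev Q : Type := Fin 4 → ℝ

/-- The arguments `(t, x, u, u_x, u_xx)` of the arbitrary element `H`. -/
abbrev K : Type := Fin 5 → ℝ

/-- The underlying first-order jet of a second-order jet. -/
def toJ1 (j : J2) : J1 := ![j 0, j 1, j 2, j 3, j 4]

/-- The coordinates `(t, x, u, u_x, u_xx)` of a second-order jet. -/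
def toK (j : J2) : K := ![j 0, j 1, j 2, j 4, j 7]

/-- The coordinates `(t, x, u, u_x)` of a first-order jet. -/
def J1.toQ (z : J1) : Q := ![z 0, z 1, z 2, z 4]

/-- The coordinates `(t, x, u, u_x)` among `(t, x, u, u_x, u_xx)`. -/
def K.toQ (k : K) : Q := ![k 0, k 1, k 2, k 3]

/-- Partial derivative of `f` with respect to the `i`-th coordinate. -/
def pd {n : ℕ} (i : Fin n) (f : (Fin n → ℝ) → ℝ) (z : Fin n → ℝ) : ℝ :=
  fderiv ℝ f z (Pi.single i 1)

/-- `f` is infinitely differentiable in some neighbourhood of `a`. -/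
def SmoothNear {E F : Type*} [NormedAddCommGroup E] [NormedSpace ℝ E]
    [NormedAddCommGroup F] [NormedSpace ℝ F] (f : E → F) (a : E) : Prop :=
  ∀ᶠ z in 𝓝 a, ContDiffAt ℝ ∞ f z

/-! ### Contact transformations and their prolongation -/

/-- The contact form `du - u_t dt - u_x dx` at `z`, evaluated at the tangent vector `v`. -/
def contactForm (z v : J1) : ℝ := v 2 - z 3 * v 0 - z 4 * v 1

/-- `Φ` is a contact transformation near `z₀`: a smooth local diffeomorphism of the space of
first-order jets which multiplies the contact form by a nonvanishing function. -/
structure IsContactAt (Φ : J1 → J1) (z₀ : J1) : Prop where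
  smooth : SmoothNear Φ z₀
  bijective : Function.Bijective (fderiv ℝ Φ z₀)
  contact : ∀ᶠ z in 𝓝 z₀, ∃ c : ℝ, c ≠ 0 ∧
    ∀ v : J1, contactForm (Φ z) (fderiv ℝ Φ z v) = c * contactForm z v

/-- The plane in the tangent space of the space of first-order jets given by a second-order jet:
it is spanned by the (truncated) total derivatives
`D_t = ∂_t + u_t ∂_u + u_tt ∂_{u_t} + u_tx ∂_{u_x}` and
`D_x = ∂_x + u_x ∂_u + u_tx ∂_{u_t} + u_xx ∂_{u_x}`. -/
def jetPlane (j : J2) : Submodule ℝ J1 :=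
  Submodule.span ℝ {![1, 0, j 3, j 5, j 6], ![0, 1, j 4, j 6, j 7]}

/-- The second prolongation of `Φ` is defined at `j`, with value `j'`. -/
def IsProlongation (Φ : J1 → J1) (j j' : J2) : Prop :=
  Φ (toJ1 j) = toJ1 j' ∧
    (jetPlane j).map (fderiv ℝ Φ (toJ1 j) : J1 →ₗ[ℝ] J1) = jetPlane j'

/-! ### The class of equations -/

/-- An equation `u_t = H(t, x, u, u_x, u_xx)` of the class: the right-hand side `H` is smooth on an
open set, and `H_{u_xx} ≠ 0` there. -/
structure EvolEq where
  dom : Set K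
  isOpen_dom : IsOpen dom
  rhs : K → ℝ
  smooth : ContDiffOn ℝ ∞ rhs dom
  nondeg : ∀ k ∈ dom, pd 4 rhs k ≠ 0

/-- The point `(j, h)` lies on the graph of the arbitrary element `H`, considered as a function on
the space of second-order jets. -/
def EvolEq.OnGraph (H : EvolEq) (j : J2) (h : ℝ) : Prop :=
  toK j ∈ H.dom ∧ h = H.rhs (toK j)

/-- The manifold defined by the equation in the space of second-order jets. -/
def EvolEq.manifold (H : EvolEq) : Set J2 := {j | H.OnGraph j (j 3)}

/-- `(H, H', Φ)` is a contact admissible transformation near the point `j₀` of the manifold of `H`: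
`Φ` is a contact transformation whose second prolongation is defined at `j₀` and, near `j₀`,
transforms the manifold of `H` to the manifold of `H'`. -/
structure IsAdmissible (H H' : EvolEq) (Φ : J1 → J1) (j₀ : J2) : Prop where
  mem : j₀ ∈ H.manifold
  contact : IsContactAt Φ (toJ1 j₀)
  defined : ∃ j', IsProlongation Φ j₀ j'
  maps : ∀ᶠ j in 𝓝 j₀, ∀ j', IsProlongation Φ j j' → (j ∈ H.manifold ↔ j' ∈ H'.manifold)

/-! ### The contact equivalence group -/

/-- Consider the transformation `Ψ : (j, h) ↦ (j', η (j, h))` of the space of variables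
`(t, x, u, u_t, u_x, u_tt, u_tx, u_xx, H)`, where `j'` is the prolongation of `Φ` at `j`.
The predicate says that, over the set `D`, the transformation `Ψ` maps the arbitrary element `H`
(its graph) to `H'`, and that `Φ` maps the equation with the arbitrary element `H` to the one
with `H'`. -/
def Transforms (Φ : J1 → J1) (η : J2 × ℝ → ℝ) (D : Set (J2 × ℝ)) (H H' : EvolEq) : Prop :=
  (∀ j h j', (j, h) ∈ D → IsProlongation Φ j j' →
      (H.OnGraph j h ↔ H'.OnGraph j' (η (j, h)))) ∧
  (∀ j j', (j, j 3) ∈ D → IsProlongation Φ j j' → (j ∈ H.manifold ↔ j' ∈ H'.manifold))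

/-- `Ψ = (Φ, η)` is a contact equivalence transformation of the class near `j₀` (with the value
`H = u_t` of the arbitrary element, so that equations passing through `j₀` are concerned):
a nondegenerate transformation of the space of variables `(t, x, u, …, u_xx, H)` which projects to a
contact transformation `Φ` and to its prolongation, and which maps the class onto itself: for any
equation of the class it gives an equation of the class to which `Φ` maps the former equation,
and any equation of the class arises in this way. -/
structure IsEquivalence (Φ : J1 → J1) (η : J2 × ℝ → ℝ) (j₀ : J2) : Prop where
  contact : IsContactAt Φ (toJ1 j₀)
  defined : ∃ j', IsProlongation Φ j₀ j'
  smooth : SmoothNear η (j₀, j₀ 3)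
  nondeg : deriv (fun h => η (j₀, h)) (j₀ 3) ≠ 0
  class_onto : ∃ D ∈ 𝓝 (j₀, j₀ 3),
    (∀ H : EvolEq, ∃ H' : EvolEq, Transforms Φ η D H H') ∧
    (∀ H' : EvolEq, ∃ H : EvolEq, Transforms Φ η D H H')

/-- The class is normalized with respect to contact transformations: any contact admissible
transformation `(H, H', Φ)` is generated by a contact equivalence transformation, i.e., there is a
contact equivalence transformation which maps `H` to `H'` and projects to `Φ`. -/
def ContactNormalized : Prop :=
  ∀ (H H' : EvolEq) (Φ : J1 → J1) (j₀ : J2), IsAdmissible H H' Φ j₀ →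
    ∃ η : J2 × ℝ → ℝ, IsEquivalence Φ η j₀ ∧ ∃ D ∈ 𝓝 (j₀, j₀ 3), Transforms Φ η D H H'

/-! ### The explicit transformations -/

/-- `F_x + F_u u_x`. -/
def dx0 (F : Q → ℝ) (q : Q) : ℝ := pd 1 F q + pd 2 F q * q 3

/-- `D_x F = F_x + F_u u_x + F_{u_x} u_xx`. -/
def Dx (F : Q → ℝ) (k : K) : ℝ := dx0 F k.toQ + pd 3 F k.toQ * k 4

open Classical in
/-- `V = (U_x + U_u u_x) / (X_x + X_u u_x)` or `V = U_{u_x} / X_{u_x}`. -/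
def V (X U : Q → ℝ) (q : Q) : ℝ :=
  if dx0 X q ≠ 0 then dx0 U q / dx0 X q else pd 3 U q / pd 3 X q

/-- The transformed value `(U_u - X_u V) / T_t * h + (U_t - X_t V) / T_t` of the right-hand
side. -/
def newRhs (T : ℝ → ℝ) (X U : Q → ℝ) (q : Q) (h : ℝ) : ℝ :=
  (pd 2 U q - pd 2 X q * V X U q) / deriv T (q 0) * h +
    (pd 0 U q - pd 0 X q * V X U q) / deriv T (q 0)

/-- The transformation `t' = T(t)`, `x' = X(t, x, u, u_x)`, `u' = U(t, x, u, u_x)` prolonged to the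
first-order derivatives `u_t` and `u_x`. -/
def contactMap (T : ℝ → ℝ) (X U : Q → ℝ) (z : J1) : J1 :=
  ![T (z 0), X z.toQ, U z.toQ, newRhs T X U z.toQ (z 3), V X U z.toQ]

/-- The prolongation of the transformation to `(t, x, u, u_x, u_xx)`. -/
def mapK (T : ℝ → ℝ) (X U : Q → ℝ) (k : K) : K :=
  ![T (k 0), X k.toQ, U k.toQ, V X U k.toQ, Dx (V X U) k / Dx X k]

/-- The conditions on the parameter functions `T`, `X` and `U` near a point: smoothness, the
nondegeneracy conditions `T_t ≠ 0` and `rank ∂(X, U)/∂(x, u, u_x) = 2`, and the contact condition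
`(U_x + U_u u_x) X_{u_x} = (X_x + X_u u_x) U_{u_x}`.  The last field says that the
transformation is prolonged to `u_xx` at this point; it implies
`(X_x + X_u u_x, X_{u_x}) ≠ (0, 0)`, so that `V` is defined. -/
structure IsContactData (T : ℝ → ℝ) (X U : Q → ℝ) (k₀ : K) : Prop where
  smooth_T : SmoothNear T (k₀ 0)
  smooth_X : SmoothNear X k₀.toQ
  smooth_U : SmoothNear U k₀.toQ
  deriv_T : deriv T (k₀ 0) ≠ 0
  rank : (!![pd 1 X k₀.toQ, pd 2 X k₀.toQ, pd 3 X k₀.toQ;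
             pd 1 U k₀.toQ, pd 2 U k₀.toQ, pd 3 U k₀.toQ]).rank = 2
  contact : ∀ᶠ q in 𝓝 k₀.toQ, dx0 U q * pd 3 X q = dx0 X q * pd 3 U q
  defined : Dx X k₀ ≠ 0

end EvolContact

end

/-!
The exterior derivative of `Φ^* θ = c θ`, where `θ = du - u_t dt - u_x dx`, shows that a contact
transformation preserves the symplectic form `omega` on contact vectors up to the factor `c`
(`exists_conformal_factor`). Consequently the image of a jet plane is isotropic, so the second
prolongation exists, and is unique, wherever the total Jacobian of the transformed independent
variables does not vanish (`existsUnique_isProlongation`).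

Explicit transformations. The contact condition makes `V` smooth with `F_x + F_u u_x` and `F_{u_x}`
of `U` equal to `V` times those of `X`, and the rank condition says that the factor `U_u - X_u V` is
nonzero (`IsContactData.isRegularAt`). Hence the transformation is contact. Its prolongation induces
a local diffeomorphism of the space of `(t, x, u, u_x, u_xx)`, and transporting right-hand sides
along it in both directions shows that the class is mapped onto itself
(`IsContactData.isEquivalence`).

Admissible transformations. On the manifold `u_t = H` the derivatives `u_tt` and `u_tx` are free.
Moving `u_tt` alone does not change the image first-order jet, hence, as `H'_{u_xx} ≠ 0`, it does
not change the image value of `u_xx` either. A computation with `omega` turns this into `D_x T = 0`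
(`fderiv_totX_eq_zero`), and splitting with respect to `u_tx`, `u_xx` and `u_x` gives `T = T(t)`
(`IsAdmissible.exists_time`). Then `∂_{u_t}` spans the radical of `omega` on contact vectors with
`dt = 0`; the radical is preserved, so `X`, `U` and the transformed `u_x` do not depend on `u_t`
(`IsContactAt.pd_ut_eq_zero`), and the contact condition in coordinates yields the explicit form
(`IsContactAt.exists_form`, `IsAdmissible.exists_form`).

Normalization follows at once. For an equivalence transformation, applying this form to
equations with `H = h + u_xx - a` determines `Φ` and all values of `η`
(`IsEquivalence.exists_form`).
-/

namespace EvolContact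

/-! ### Calculus in coordinates -/

theorem fderiv_eq_sum {n : ℕ} (f : (Fin n → ℝ) → ℝ) (z v : Fin n → ℝ) :
    fderiv ℝ f z v = ∑ i, v i * pd i f z := by
  conv_lhs => rw [← Finset.univ_sum_single v]
  rw [map_sum]
  refine Finset.sum_congr rfl fun i _ => ?_
  have : (Pi.single i (v i) : Fin n → ℝ) = v i • Pi.single i 1 := by
    rw [← Pi.single_smul, smul_eq_mul, mul_one]
  rw [this, map_smul, smul_eq_mul]
  rfl

theorem SmoothNear.eventually {E F : Type*} [NormedAddCommGroup E] [NormedSpace ℝ E]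
    [NormedAddCommGroup F] [NormedSpace ℝ F] {f : E → F} {a : E} (h : SmoothNear f a) :
    ∀ᶠ z in 𝓝 a, SmoothNear f z :=
  eventually_eventually_nhds.2 h

theorem SmoothNear.contDiffAt {E F : Type*} [NormedAddCommGroup E] [NormedSpace ℝ E]
    [NormedAddCommGroup F] [NormedSpace ℝ F] {f : E → F} {a : E} (h : SmoothNear f a) :
    ContDiffAt ℝ ∞ f a :=
  h.self_of_nhds

theorem SmoothNear.differentiableAt {E F : Type*} [NormedAddCommGroup E] [NormedSpace ℝ E]
    [NormedAddCommGroup F] [NormedSpace ℝ F] {f : E → F} {a : E} (h : SmoothNear f a) :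
    DifferentiableAt ℝ f a :=
  h.contDiffAt.differentiableAt (by simp)

theorem SmoothNear.congr {E F : Type*} [NormedAddCommGroup E] [NormedSpace ℝ E]
    [NormedAddCommGroup F] [NormedSpace ℝ F] {f g : E → F} {a : E} (h : SmoothNear f a)
    (hg : ∀ᶠ z in 𝓝 a, g z = f z) : SmoothNear g a := by
  filter_upwards [h, eventually_eventually_nhds.2 hg] with z hz hgz
  exact hz.congr_of_eventuallyEq hgz

theorem SmoothNear.comp {E F G : Type*} [NormedAddCommGroup E] [NormedSpace ℝ E]
    [NormedAddCommGroup F] [NormedSpace ℝ F] [NormedAddCommGroup G] [NormedSpace ℝ G]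
    {f : F → G} {g : E → F} {a : E} (hf : SmoothNear f (g a)) (hg : ContDiff ℝ ∞ g) :
    SmoothNear (fun z => f (g z)) a := by
  filter_upwards [hg.continuous.continuousAt.eventually hf] with z hz
  exact ContDiffAt.comp z hz hg.contDiffAt

theorem contDiffAt_pd {n : ℕ} (i : Fin n) {f : (Fin n → ℝ) → ℝ} {z : Fin n → ℝ}
    (h : ContDiffAt ℝ ∞ f z) : ContDiffAt ℝ ∞ (pd i f) z :=
  (h.fderiv_right (m := ∞) (by simp)).clm_apply contDiffAt_const

theorem SmoothNear.pd {n : ℕ} (i : Fin n) {f : (Fin n → ℝ) → ℝ} {a : Fin n → ℝ}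
    (h : SmoothNear f a) : SmoothNear (pd i f) a :=
  h.mono fun _ hz => contDiffAt_pd i hz

theorem smoothNear_pi {E : Type*} [NormedAddCommGroup E] [NormedSpace ℝ E] {n : ℕ}
    {f : E → Fin n → ℝ} {a : E} : SmoothNear f a ↔ ∀ i, SmoothNear (fun z => f z i) a := by
  simp only [SmoothNear, contDiffAt_pi, Filter.eventually_all]

theorem fderiv_coord {E : Type*} [NormedAddCommGroup E] [NormedSpace ℝ E] {n : ℕ}
    {f : E → Fin n → ℝ} {a : E} (h : DifferentiableAt ℝ f a) (v : E) (i : Fin n) :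
    fderiv ℝ f a v i = fderiv ℝ (fun z => f z i) a v := by
  rw [fderiv_pi (fun i => differentiableAt_pi.1 h i)]
  rfl

theorem isSymmSndFDerivAt_of_smooth {E : Type*} [NormedAddCommGroup E] [NormedSpace ℝ E]
    {f : E → ℝ} {z : E} (h : ContDiffAt ℝ ∞ f z) : IsSymmSndFDerivAt ℝ f z :=
  h.isSymmSndFDerivAt (by
    rw [minSmoothness_of_isRCLikeNormedField]
    exact WithTop.coe_le_coe.2 le_top)

theorem pd_comm {n : ℕ} (i k : Fin n) {f : (Fin n → ℝ) → ℝ} {z : Fin n → ℝ}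
    (h : ContDiffAt ℝ ∞ f z) : pd i (pd k f) z = pd k (pd i f) z := by
  have hd : DifferentiableAt ℝ (fderiv ℝ f) z :=
    (h.fderiv_right (m := ∞) (by simp)).differentiableAt (by simp)
  have key : ∀ a b : Fin n, pd a (pd b f) z =
      fderiv ℝ (fderiv ℝ f) z (Pi.single a 1) (Pi.single b 1) := by
    intro a b
    have := (hd.hasFDerivAt.clm_apply
      (hasFDerivAt_const (Pi.single b (1 : ℝ) : Fin n → ℝ) z)).fderiv
    change fderiv ℝ (fun y => fderiv ℝ f y (Pi.single b 1)) z (Pi.single a 1) = _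
    rw [this]
    simp
  rw [key, key]
  exact (isSymmSndFDerivAt_of_smooth h).eq _ _

/-- A function whose partial derivatives with respect to the coordinates in `S` vanish near `a`
does not depend on these coordinates near `a`. -/
theorem eventually_eq_of_pd_eq_zero {n : ℕ} (S : Fin n → Prop) [DecidablePred S]
    {f : (Fin n → ℝ) → ℝ} {a : Fin n → ℝ} (hf : SmoothNear f a)
    (h : ∀ i, S i → ∀ᶠ z in 𝓝 a, pd i f z = 0) :
    ∀ᶠ z in 𝓝 a, f z = f fun i => if S i then a i else z i := by
  have h' : ∀ᶠ z in 𝓝 a, DifferentiableAt ℝ f z ∧ ∀ i, S i → pd i f z = 0 := by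
    refine (hf.eventually.mono fun z hz => hz.differentiableAt).and ?_
    rw [Filter.eventually_all]
    intro i
    by_cases hi : S i
    · exact (h i hi).mono fun z hz _ => hz
    · exact Filter.Eventually.of_forall fun z hz => absurd hz hi
  obtain ⟨r, hr, hball⟩ := Metric.eventually_nhds_iff_ball.1 h'
  filter_upwards [Metric.ball_mem_nhds a hr] with z hz
  set z' : Fin n → ℝ := fun i => if S i then a i else z i with hz'
  have hz'b : z' ∈ Metric.ball a r := by
    rw [Metric.mem_ball, dist_pi_lt_iff hr] at hz ⊢
    intro i
    by_cases hi : S i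
    · simp [hz', hi, hr]
    · simpa [hz', hi] using hz i
  have hseg : ∀ s ∈ Set.Icc (0 : ℝ) 1, AffineMap.lineMap z z' s ∈ Metric.ball a r := fun s hs =>
    (convex_ball a r).lineMap_mem hz hz'b hs
  have hder : ∀ s ∈ Set.Icc (0 : ℝ) 1, HasDerivWithinAt
      (fun s : ℝ => f (AffineMap.lineMap z z' s)) 0 (Set.Icc 0 1) s := by
    intro s hs
    obtain ⟨hd, hp⟩ := hball _ (hseg s hs)
    have := (hd.hasFDerivAt.comp_hasDerivAt s
      (AffineMap.hasDerivAt_lineMap (a := z) (b := z') (x := s))).hasDerivWithinAt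
      (s := Set.Icc 0 1)
    have h0 : fderiv ℝ f (AffineMap.lineMap z z' s) (z' - z) = 0 := ?_
    · rw [h0] at this
      exact this
    rw [fderiv_eq_sum]
    refine Finset.sum_eq_zero fun i _ => ?_
    by_cases hi : S i
    · rw [hp i hi, mul_zero]
    · simp [hz', hi]
  have := (convex_Icc (0 : ℝ) 1).norm_image_sub_le_of_norm_hasDerivWithin_le (C := 0) hder
    (fun _ _ => by simp) (Set.left_mem_Icc.2 zero_le_one) (Set.right_mem_Icc.2 zero_le_one)
  simp only [AffineMap.lineMap_apply_zero, AffineMap.lineMap_apply_one, zero_mul,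
    norm_le_zero_iff, sub_eq_zero] at this
  exact this.symm

/-- An affine function of one variable which vanishes near a point is zero. -/
theorem affine_eq_zero {a b s₀ : ℝ} (h : ∀ᶠ s in 𝓝 s₀, a + b * s = 0) : a = 0 ∧ b = 0 := by
  obtain ⟨s, hs, hne⟩ := ((h.filter_mono nhdsWithin_le_nhds).and
    (self_mem_nhdsWithin : {s₀}ᶜ ∈ 𝓝[≠] s₀)).exists
  have h0 := h.self_of_nhds
  have hb : b = 0 := by
    have : b * (s - s₀) = 0 := by linear_combination hs - h0
    exact (mul_eq_zero.1 this).resolve_right (sub_ne_zero.2 hne)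
  exact ⟨by simpa [hb] using h0, hb⟩

/-! ### Jet coordinates as linear maps -/

/-- `J1.toQ` as a continuous linear map. -/
noncomputable def J1.toQL : J1 →L[ℝ] Q := LinearMap.toContinuousLinearMap
  { toFun := J1.toQ
    map_add' := fun x y => by ext i; fin_cases i <;> rfl
    map_smul' := fun x y => by ext i; fin_cases i <;> rfl }

/-- `K.toQ` as a continuous linear map. -/
noncomputable def K.toQL : K →L[ℝ] Q := LinearMap.toContinuousLinearMap
  { toFun := K.toQ
    map_add' := fun x y => by ext i; fin_cases i <;> rfl
    map_smul' := fun x y => by ext i; fin_cases i <;> rfl }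

theorem contDiff_J1_toQ : ContDiff ℝ ∞ J1.toQ := J1.toQL.contDiff

theorem contDiff_K_toQ : ContDiff ℝ ∞ K.toQ := K.toQL.contDiff

theorem continuous_toJ1 : Continuous toJ1 := by
  unfold toJ1; fun_prop

theorem continuous_toK : Continuous toK := by
  unfold toK; fun_prop

theorem fderiv_comp_J1_toQ {f : Q → ℝ} {z : J1} (h : DifferentiableAt ℝ f z.toQ) (v : J1) :
    fderiv ℝ (fun z : J1 => f z.toQ) z v = fderiv ℝ f z.toQ v.toQ := by
  have := (HasFDerivAt.comp (g := f) (f := J1.toQ) z h.hasFDerivAt (J1.toQL.hasFDerivAt)).fderiv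
  change fderiv ℝ (f ∘ J1.toQ) z v = _
  rw [this]
  rfl

theorem fderiv_comp_K_toQ {f : Q → ℝ} {k : K} (h : DifferentiableAt ℝ f k.toQ) (v : K) :
    fderiv ℝ (fun k : K => f k.toQ) k v = fderiv ℝ f k.toQ v.toQ := by
  have := (HasFDerivAt.comp (g := f) (f := K.toQ) k h.hasFDerivAt (K.toQL.hasFDerivAt)).fderiv
  change fderiv ℝ (f ∘ K.toQ) k v = _
  rw [this]
  rfl

/-! ### The conformally symplectic structure of the contact distribution -/

/-- The differential `dt ∧ du_t + dx ∧ du_x` of the contact form, up to sign; it does not depend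
on the point. -/
def omega (v w : J1) : ℝ := v 3 * w 0 + v 4 * w 1 - w 3 * v 0 - w 4 * v 1

/-- The exterior derivative of the identity `Φ^* θ = c θ`, restricted to contact vectors. -/
theorem exists_conformal_factor {Φ : J1 → J1} {z : J1} (hs : SmoothNear Φ z)
    (hc : ∀ᶠ y in 𝓝 z, ∃ c : ℝ, c ≠ 0 ∧
      ∀ v : J1, contactForm (Φ y) (fderiv ℝ Φ y v) = c * contactForm y v) :
    ∃ c : ℝ, c ≠ 0 ∧
      (∀ v : J1, contactForm (Φ z) (fderiv ℝ Φ z v) = c * contactForm z v) ∧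
      ∀ v w : J1, contactForm z v = 0 → contactForm z w = 0 →
        omega (fderiv ℝ Φ z v) (fderiv ℝ Φ z w) = c * omega v w := by
  set e : J1 := Pi.single 2 1 with he
  have hθe : ∀ y, contactForm y e = 1 := fun y => by simp [contactForm, he]
  -- the factor is the value of the transformed contact form at `∂_u`, hence it is smooth
  set g : J1 → J1 → ℝ := fun v y => contactForm (Φ y) (fderiv ℝ Φ y v) with hg
  have hgc : ∀ᶠ y in 𝓝 z, g e y ≠ 0 ∧ ∀ v, g v y = g e y * contactForm y v := by
    filter_upwards [hc] with y ⟨c, hc0, hcv⟩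
    have : g e y = c := by simp only [hg, hcv, hθe, mul_one]
    rw [this]
    exact ⟨hc0, hcv⟩
  have hcomp : ∀ i, ContDiffAt ℝ ∞ (fun y => Φ y i) z := contDiffAt_pi.1 hs.contDiffAt
  have hB : ∀ i, HasFDerivAt (fderiv ℝ (fun y => Φ y i))
      (fderiv ℝ (fderiv ℝ (fun y => Φ y i)) z) z := fun i =>
    (((hcomp i).fderiv_right (m := ∞) (by simp)).differentiableAt (by simp)).hasFDerivAt
  have hF : ∀ i, HasFDerivAt (fun y => Φ y i) (fderiv ℝ (fun y => Φ y i) z) z := fun i =>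
    ((hcomp i).differentiableAt (by simp)).hasFDerivAt
  have hgform : ∀ v, ∀ᶠ y in 𝓝 z, g v y = fderiv ℝ (fun y => Φ y 2) y v
      - Φ y 3 * fderiv ℝ (fun y => Φ y 0) y v - Φ y 4 * fderiv ℝ (fun y => Φ y 1) y v := by
    intro v
    filter_upwards [hs.eventually] with y hy
    simp only [hg, contactForm, fderiv_coord hy.differentiableAt]
  have hBv : ∀ i v, HasFDerivAt (fun y => fderiv ℝ (fun y => Φ y i) y v) _ z := fun i v =>
    (hB i).clm_apply (hasFDerivAt_const v z)
  have hgder : ∀ v, HasFDerivAt (g v) _ z := fun v =>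
    (((hBv 2 v).sub ((hF 3).mul (hBv 0 v))).sub ((hF 4).mul (hBv 1 v))).congr_of_eventuallyEq
      (hgform v)
  have hz3 : ∀ i, HasFDerivAt (fun y : J1 => y i)
      (ContinuousLinearMap.proj (R := ℝ) (φ := fun _ : Fin 5 => ℝ) i) z := fun i =>
    hasFDerivAt_apply i z
  have hθ : ∀ v, HasFDerivAt (fun y => contactForm y v) _ z := fun v =>
    ((hasFDerivAt_const (v 2) z).sub ((hz3 3).mul_const (v 0))).sub ((hz3 4).mul_const (v 1))
  refine ⟨g e z, hgc.self_of_nhds.1, fun v => hgc.self_of_nhds.2 v, fun v w hv hw => ?_⟩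
  have hEq : ∀ v, fderiv ℝ (g v) z = fderiv ℝ (fun y => g e y * contactForm y v) z := fun v =>
    Filter.EventuallyEq.fderiv_eq (hgc.mono fun y hy => hy.2 v)
  have h1 := congrArg (fun L : J1 →L[ℝ] ℝ => L w) (hEq v)
  have h2 := congrArg (fun L : J1 →L[ℝ] ℝ => L v) (hEq w)
  rw [((hgder e).differentiableAt.hasFDerivAt.fun_mul (hθ v)).fderiv, (hgder v).fderiv] at h1
  rw [((hgder e).differentiableAt.hasFDerivAt.fun_mul (hθ w)).fderiv, (hgder w).fderiv] at h2
  have hsym : ∀ i, fderiv ℝ (fderiv ℝ (fun y => Φ y i)) z v w =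
      fderiv ℝ (fderiv ℝ (fun y => Φ y i)) z w v := fun i =>
    (isSymmSndFDerivAt_of_smooth (hcomp i)).eq v w
  simp only [_root_.neg_apply, _root_.sub_apply, _root_.add_apply,
    _root_.smul_apply, ContinuousLinearMap.flip_apply,
    ContinuousLinearMap.comp_apply, _root_.zero_apply, smul_eq_mul,
    ContinuousLinearMap.proj_apply, hv, hw, hsym, zero_mul, add_zero, map_zero, zero_sub,
    zero_add] at h1 h2
  simp only [omega, fderiv_coord hs.differentiableAt]
  linear_combination h1 - h2

/-- The derivative of a transformation that preserves the contact form up to a nonvanishing factor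
is invertible, since `omega` is nondegenerate on contact vectors. -/
theorem isContactAt_of_smoothNear {Φ : J1 → J1} {z : J1} (hs : SmoothNear Φ z)
    (hc : ∀ᶠ y in 𝓝 z, ∃ c : ℝ, c ≠ 0 ∧
      ∀ v : J1, contactForm (Φ y) (fderiv ℝ Φ y v) = c * contactForm y v) :
    IsContactAt Φ z := by
  refine ⟨hs, ?_, hc⟩
  obtain ⟨c, hc0, hθ, hω⟩ := exists_conformal_factor hs hc
  have hinj : Function.Injective (fderiv ℝ Φ z : J1 →ₗ[ℝ] J1) := by
    rw [injective_iff_map_eq_zero]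
    intro v hv
    replace hv : fderiv ℝ Φ z v = 0 := hv
    have hv1 : contactForm z v = 0 := by
      have := hθ v
      rw [hv] at this
      simpa [contactForm, hc0, eq_comm] using this
    have hv2 : ∀ w, contactForm z w = 0 → omega v w = 0 := by
      intro w hw
      have := hω v w hv1 hw
      rw [hv] at this
      simpa [omega, hc0, eq_comm] using this
    have a0 := hv2 (Pi.single 3 1) (by simp [contactForm])
    have a1 := hv2 (Pi.single 4 1) (by simp [contactForm])
    have a3 := hv2 ![1, 0, z 3, 0, 0] (by simp [contactForm])
    have a4 := hv2 ![0, 1, z 4, 0, 0] (by simp [contactForm])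
    simp [omega] at a0 a1 a3 a4
    simp [contactForm, a0, a1] at hv1
    ext i
    fin_cases i <;> simp [*]
  exact ⟨hinj, LinearMap.injective_iff_surjective.1 hinj⟩

theorem IsContactAt.eventually {Φ : J1 → J1} {z : J1} (h : IsContactAt Φ z) :
    ∀ᶠ y in 𝓝 z, IsContactAt Φ y := by
  filter_upwards [h.smooth.eventually, eventually_eventually_nhds.2 h.contact] with y h1 h2
  exact isContactAt_of_smoothNear h1 h2

theorem IsContactAt.congr {Φ Φ' : J1 → J1} {z : J1} (h : IsContactAt Φ z)
    (he : ∀ᶠ y in 𝓝 z, Φ' y = Φ y) : IsContactAt Φ' z := by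
  refine isContactAt_of_smoothNear (h.smooth.congr he) ?_
  filter_upwards [h.contact, eventually_eventually_nhds.2 he] with y hy hey
  rw [Filter.EventuallyEq.fderiv_eq hey, hey.self_of_nhds]
  exact hy

/-! ### Second prolongation -/

/-- The truncated total derivative `D_t` at `j`. -/
def totT (j : J2) : J1 := ![1, 0, j 3, j 5, j 6]

/-- The truncated total derivative `D_x` at `j`. -/
def totX (j : J2) : J1 := ![0, 1, j 4, j 6, j 7]

/-- The total Jacobian `D_t T D_x X - D_t X D_x T` of the transformed independent variables. -/
noncomputable def totJac (Φ : J1 → J1) (j : J2) : ℝ :=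
  fderiv ℝ Φ (toJ1 j) (totT j) 0 * fderiv ℝ Φ (toJ1 j) (totX j) 1 -
    fderiv ℝ Φ (toJ1 j) (totT j) 1 * fderiv ℝ Φ (toJ1 j) (totX j) 0

theorem mem_jetPlane_iff {j : J2} {v : J1} : v ∈ jetPlane j ↔
    v 2 = v 0 * j 3 + v 1 * j 4 ∧ v 3 = v 0 * j 5 + v 1 * j 6 ∧ v 4 = v 0 * j 6 + v 1 * j 7 := by
  rw [jetPlane, Submodule.mem_span_pair]
  constructor
  · rintro ⟨a, b, rfl⟩
    simp
  · rintro ⟨h2, h3, h4⟩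
    refine ⟨v 0, v 1, ?_⟩
    ext i
    fin_cases i <;> simp [*]

theorem isProlongation_iff {Φ : J1 → J1} {j j' : J2} : IsProlongation Φ j j' ↔
    Φ (toJ1 j) = toJ1 j' ∧ totJac Φ j ≠ 0 ∧
      fderiv ℝ Φ (toJ1 j) (totT j) ∈ jetPlane j' ∧
      fderiv ℝ Φ (toJ1 j) (totX j) ∈ jetPlane j' := by
  refine and_congr_right fun _ => ?_
  rw [totJac]
  have hmap : (jetPlane j).map (fderiv ℝ Φ (toJ1 j) : J1 →ₗ[ℝ] J1) =
      Submodule.span ℝ {fderiv ℝ Φ (toJ1 j) (totT j), fderiv ℝ Φ (toJ1 j) (totX j)} := by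
    rw [jetPlane, Submodule.map_span, Set.image_pair]
    rfl
  rw [hmap]
  set a := fderiv ℝ Φ (toJ1 j) (totT j)
  set b := fderiv ℝ Φ (toJ1 j) (totX j)
  constructor
  · intro h
    refine ⟨?_, h ▸ Submodule.subset_span (by simp), h ▸ Submodule.subset_span (by simp)⟩
    have hT : totT j' ∈ Submodule.span ℝ {a, b} := by rw [h, mem_jetPlane_iff]; simp [totT]
    have hX : totX j' ∈ Submodule.span ℝ {a, b} := by rw [h, mem_jetPlane_iff]; simp [totX]
    obtain ⟨p, q, h1⟩ := Submodule.mem_span_pair.1 hT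
    obtain ⟨r, s, h2⟩ := Submodule.mem_span_pair.1 hX
    have h10 := congrFun h1 0
    have h11 := congrFun h1 1
    have h20 := congrFun h2 0
    have h21 := congrFun h2 1
    simp [totT, totX] at h10 h11 h20 h21
    intro h0
    have : (p * s - q * r) * (a 0 * b 1 - a 1 * b 0) = 1 := by
      linear_combination (p * a 1 + q * b 1) * (-h20) + h10 * (r * a 1 + s * b 1) + h21
    rw [h0, mul_zero] at this
    exact zero_ne_one this
  · rintro ⟨h0, ha, hb⟩
    apply le_antisymm
    · rw [Submodule.span_le]
      rintro v (rfl | rfl)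
      · exact ha
      · exact hb
    · intro v hv
      rw [Submodule.mem_span_pair]
      rw [mem_jetPlane_iff] at ha hb hv
      obtain ⟨d, hd⟩ : ∃ d, d = a 0 * b 1 - a 1 * b 0 := ⟨_, rfl⟩
      rw [← hd] at h0
      have e0 : (v 0 * b 1 - v 1 * b 0) / d * a 0 + (a 0 * v 1 - a 1 * v 0) / d * b 0 = v 0 := by
        field_simp; rw [hd]; ring
      have e1 : (v 0 * b 1 - v 1 * b 0) / d * a 1 + (a 0 * v 1 - a 1 * v 0) / d * b 1 = v 1 := by
        field_simp; rw [hd]; ring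
      refine ⟨(v 0 * b 1 - v 1 * b 0) / d, (a 0 * v 1 - a 1 * v 0) / d, ?_⟩
      ext i
      fin_cases i
      · exact e0
      · exact e1
      · simp only [Fin.reduceFinMk, Pi.add_apply, Pi.smul_apply, smul_eq_mul, ha.1, hb.1, hv.1]
        linear_combination j' 3 * e0 + j' 4 * e1
      · simp only [Fin.reduceFinMk, Pi.add_apply, Pi.smul_apply, smul_eq_mul, ha.2.1, hb.2.1, hv.2.1]
        linear_combination j' 5 * e0 + j' 6 * e1
      · simp only [Fin.reduceFinMk, Pi.add_apply, Pi.smul_apply, smul_eq_mul, ha.2.2, hb.2.2, hv.2.2]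
        linear_combination j' 6 * e0 + j' 7 * e1

theorem IsProlongation.uxx {Φ : J1 → J1} {j j' : J2} (h : IsProlongation Φ j j') :
    j' 7 = (fderiv ℝ Φ (toJ1 j) (totT j) 0 * fderiv ℝ Φ (toJ1 j) (totX j) 4 -
      fderiv ℝ Φ (toJ1 j) (totT j) 4 * fderiv ℝ Φ (toJ1 j) (totX j) 0) / totJac Φ j := by
  obtain ⟨_, h0, ha, hb⟩ := isProlongation_iff.1 h
  rw [mem_jetPlane_iff] at ha hb
  rw [eq_div_iff h0, ha.2.2, hb.2.2, totJac]
  ring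

theorem contactForm_totT (j : J2) : contactForm (toJ1 j) (totT j) = 0 := by
  simp [contactForm, totT, toJ1]

theorem contactForm_totX (j : J2) : contactForm (toJ1 j) (totX j) = 0 := by
  simp [contactForm, totX, toJ1]

/-- The second prolongation of a contact transformation is defined wherever the total Jacobian does
not vanish: as the image of a jet plane is isotropic for `omega`, both ways of computing the mixed
derivative agree. -/
theorem existsUnique_isProlongation {Φ : J1 → J1} {j : J2} (h : IsContactAt Φ (toJ1 j))
    (h0 : totJac Φ j ≠ 0) : ∃! j', IsProlongation Φ j j' := by
  obtain ⟨c, hc0, hθ, hω⟩ := exists_conformal_factor h.smooth h.contact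
  have hωj := hω _ _ (contactForm_totT j) (contactForm_totX j)
  have hT := hθ (totT j)
  have hX := hθ (totX j)
  rw [contactForm_totT, mul_zero] at hT
  rw [contactForm_totX, mul_zero] at hX
  have hω0 : omega (totT j) (totX j) = 0 := by simp [omega, totT, totX]
  rw [hω0, mul_zero] at hωj
  simp only [isProlongation_iff]
  have h0' := h0
  rw [totJac] at h0'
  set a := fderiv ℝ Φ (toJ1 j) (totT j)
  set b := fderiv ℝ Φ (toJ1 j) (totX j)
  set z := Φ (toJ1 j)
  set d := a 0 * b 1 - a 1 * b 0 with hd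
  simp only [contactForm, omega] at hT hX hωj
  refine ⟨![z 0, z 1, z 2, z 3, z 4, (a 3 * b 1 - b 3 * a 1) / d, (a 0 * b 3 - b 0 * a 3) / d,
    (a 0 * b 4 - b 0 * a 4) / d], ⟨?_, h0, ?_, ?_⟩, ?_⟩
  · ext i; fin_cases i <;> rfl
  · rw [mem_jetPlane_iff]
    refine ⟨?_, ?_, ?_⟩
    · simp; linear_combination hT
    · simp; field_simp; rw [hd]; ring
    · simp; field_simp; rw [hd]; linear_combination a 0 * hωj
  · rw [mem_jetPlane_iff]
    refine ⟨?_, ?_, ?_⟩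
    · simp; linear_combination hX
    · simp; field_simp; rw [hd]; ring
    · simp; field_simp; rw [hd]; linear_combination b 0 * hωj
  · rintro y ⟨hy, _, ha, hb⟩
    rw [mem_jetPlane_iff] at ha hb
    have hyi : ∀ i, z i = toJ1 y i := fun i => by rw [hy]
    have h5 : y 5 = (a 3 * b 1 - b 3 * a 1) / d := by
      rw [eq_div_iff h0', hd, ha.2.1, hb.2.1]; ring
    have h6 : y 6 = (a 0 * b 3 - b 0 * a 3) / d := by
      rw [eq_div_iff h0', hd, ha.2.1, hb.2.1]; ring
    have h7 : y 7 = (a 0 * b 4 - b 0 * a 4) / d := by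
      rw [eq_div_iff h0', hd, ha.2.2, hb.2.2]; ring
    ext i
    fin_cases i
    · exact (hyi 0).symm
    · exact (hyi 1).symm
    · exact (hyi 2).symm
    · exact (hyi 3).symm
    · exact (hyi 4).symm
    · exact h5
    · exact h6
    · exact h7

theorem IsProlongation.congr {Φ Φ' : J1 → J1} {j j' : J2} (h : IsProlongation Φ j j')
    (he : ∀ᶠ y in 𝓝 (toJ1 j), Φ' y = Φ y) : IsProlongation Φ' j j' := by
  rw [IsProlongation, Filter.EventuallyEq.fderiv_eq he, he.self_of_nhds]
  exact h

theorem continuousAt_fderiv_total {Φ : J1 → J1} {j : J2} (h : SmoothNear Φ (toJ1 j))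
    {w : J2 → J1} (hw : Continuous w) (i : Fin 5) :
    ContinuousAt (fun j => fderiv ℝ Φ (toJ1 j) (w j) i) j := by
  have h1 : ContinuousAt (fderiv ℝ Φ) (toJ1 j) :=
    (h.contDiffAt.fderiv_right (m := ∞) (by simp)).continuousAt
  have h2 : ContinuousAt (fun j => fderiv ℝ Φ (toJ1 j)) j :=
    ContinuousAt.comp (f := toJ1) h1 continuous_toJ1.continuousAt
  exact (continuous_apply i).continuousAt.comp (h2.clm_apply hw.continuousAt)

theorem continuous_totT : Continuous totT := by unfold totT; fun_prop

theorem continuous_totX : Continuous totX := by unfold totX; fun_prop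

theorem continuousAt_totJac {Φ : J1 → J1} {j : J2} (h : SmoothNear Φ (toJ1 j)) :
    ContinuousAt (totJac Φ) j :=
  ((continuousAt_fderiv_total h continuous_totT 0).mul
    (continuousAt_fderiv_total h continuous_totX 1)).sub
  ((continuousAt_fderiv_total h continuous_totT 1).mul
    (continuousAt_fderiv_total h continuous_totX 0))

/-! ### The explicit transformations are contact transformations -/

section Explicit

variable {T : ℝ → ℝ} {X U : Q → ℝ}

/-- The pointwise consequences of `IsContactData` in terms of `V`: it is smooth, both contact
conditions `F_x + F_u u_x` and `F_{u_x}` for `U` are those for `X` times `V`, and the factor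
`U_u - X_u V` of the contact form does not vanish. -/
structure IsRegularAt (T : ℝ → ℝ) (X U : Q → ℝ) (q : Q) : Prop where
  smooth_T : SmoothNear T (q 0)
  smooth_X : SmoothNear X q
  smooth_U : SmoothNear U q
  smooth_V : SmoothNear (V X U) q
  deriv_T : deriv T (q 0) ≠ 0
  factor : pd 2 U q - pd 2 X q * V X U q ≠ 0
  contact : ∀ᶠ p in 𝓝 q, dx0 U p = V X U p * dx0 X p ∧ pd 3 U p = V X U p * pd 3 X p

theorem SmoothNear.deriv {f : ℝ → ℝ} {a : ℝ} (h : SmoothNear f a) : SmoothNear (deriv f) a := by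
  filter_upwards [h] with z hz
  have : ContDiffAt ℝ ∞ (fun z => fderiv ℝ f z 1) z :=
    (hz.fderiv_right (m := ∞) (by simp)).clm_apply contDiffAt_const
  simpa only [fderiv_apply_one_eq_deriv] using this

theorem SmoothNear.dx0 {F : Q → ℝ} {q : Q} (h : SmoothNear F q) : SmoothNear (dx0 F) q := by
  filter_upwards [h.pd 1, h.pd 2] with p h1 h2
  exact h1.add (h2.mul (contDiff_apply ℝ ℝ (3 : Fin 4)).contDiffAt)

theorem SmoothNear.Dx {F : Q → ℝ} {k : K} (h : SmoothNear F k.toQ) : SmoothNear (Dx F) k := by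
  filter_upwards [h.dx0.comp contDiff_K_toQ, (h.pd 3).comp contDiff_K_toQ] with p h1 h2
  exact h1.add (h2.mul (contDiff_apply ℝ ℝ (4 : Fin 5)).contDiffAt)

theorem continuous_K_toQ : Continuous K.toQ := contDiff_K_toQ.continuous

theorem continuous_J1_toQ : Continuous J1.toQ := contDiff_J1_toQ.continuous

theorem IsContactData.isRegularAt {k₀ : K} (h : IsContactData T X U k₀) :
    IsRegularAt T X U k₀.toQ := by
  have hV : SmoothNear (V X U) k₀.toQ ∧ ∀ᶠ p in 𝓝 k₀.toQ,
      dx0 U p = V X U p * dx0 X p ∧ pd 3 U p = V X U p * pd 3 X p := by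
    by_cases h0 : dx0 X k₀.toQ = 0
    · have h3 : pd 3 X k₀.toQ ≠ 0 := by
        intro h3
        exact h.defined (by rw [Dx, h0, h3]; ring)
      have hev : ∀ᶠ p in 𝓝 k₀.toQ, pd 3 X p ≠ 0 ∧ V X U p = pd 3 U p / pd 3 X p := by
        filter_upwards [(h.smooth_X.pd 3).contDiffAt.continuousAt.eventually_ne h3, h.contact]
          with p hp hc
        refine ⟨hp, ?_⟩
        rw [V]
        split_ifs with hd
        · rw [div_eq_div_iff hd hp]
          linear_combination hc
        · rfl
      constructor
      · have : SmoothNear (fun p => pd 3 U p / pd 3 X p) k₀.toQ := by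
          filter_upwards [hev, h.smooth_X.pd 3, h.smooth_U.pd 3] with p hp h1 h2
          exact h2.div h1 hp.1
        exact this.congr (hev.mono fun p hp => hp.2)
      · filter_upwards [hev, h.contact] with p hp hc
        rw [hp.2]
        have := hp.1
        constructor <;> field_simp
        linear_combination hc
    · have hev : ∀ᶠ p in 𝓝 k₀.toQ, dx0 X p ≠ 0 ∧ V X U p = dx0 U p / dx0 X p := by
        filter_upwards [h.smooth_X.dx0.contDiffAt.continuousAt.eventually_ne h0] with p hp
        exact ⟨hp, by rw [V, if_pos hp]⟩
      constructor
      · have : SmoothNear (fun p => dx0 U p / dx0 X p) k₀.toQ := by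
          filter_upwards [hev, h.smooth_X.dx0, h.smooth_U.dx0] with p hp h1 h2
          exact h2.div h1 hp.1
        exact this.congr (hev.mono fun p hp => hp.2)
      · filter_upwards [hev, h.contact] with p hp hc
        rw [hp.2]
        have := hp.1
        constructor <;> field_simp
        linear_combination -hc
  refine ⟨h.smooth_T, h.smooth_X, h.smooth_U, hV.1, h.deriv_T, ?_, hV.2⟩
  -- otherwise the second row of the Jacobian matrix is `V` times the first one
  intro hc
  obtain ⟨h1, h3⟩ := hV.2.self_of_nhds
  simp only [dx0] at h1
  have hrank := h.rank
  have hmat : !![pd 1 X k₀.toQ, pd 2 X k₀.toQ, pd 3 X k₀.toQ;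
      pd 1 U k₀.toQ, pd 2 U k₀.toQ, pd 3 U k₀.toQ] = Matrix.vecMulVec ![1, V X U k₀.toQ]
      ![pd 1 X k₀.toQ, pd 2 X k₀.toQ, pd 3 X k₀.toQ] := by
    ext i j
    fin_cases i <;> fin_cases j <;> simp [Matrix.vecMulVec]
    · linear_combination h1 - k₀.toQ 3 * hc
    · linear_combination hc
    · exact h3
  rw [hmat] at hrank
  have := Matrix.rank_vecMulVec_le ![1, V X U k₀.toQ]
      ![pd 1 X k₀.toQ, pd 2 X k₀.toQ, pd 3 X k₀.toQ]
  omega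

theorem IsRegularAt.eventually {q : Q} (h : IsRegularAt T X U q) :
    ∀ᶠ p in 𝓝 q, IsRegularAt T X U p := by
  have h0 : ContinuousAt (fun p : Q => p 0) q := (continuous_apply 0).continuousAt
  have hf : ContinuousAt (fun p => pd 2 U p - pd 2 X p * V X U p) q :=
    (h.smooth_U.pd 2).contDiffAt.continuousAt.sub
      ((h.smooth_X.pd 2).contDiffAt.continuousAt.mul h.smooth_V.contDiffAt.continuousAt)
  have hT : ContinuousAt (fun p : Q => deriv T (p 0)) q :=
    ContinuousAt.comp (f := fun p : Q => p 0) h.smooth_T.deriv.contDiffAt.continuousAt h0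
  filter_upwards [h0.eventually h.smooth_T.eventually, h.smooth_X.eventually,
    h.smooth_U.eventually, h.smooth_V.eventually, hT.eventually_ne h.deriv_T,
    hf.eventually_ne h.factor, eventually_eventually_nhds.2 h.contact] with p h1 h2 h3 h4 h5 h6 h7
  exact ⟨h1, h2, h3, h4, h5, h6, h7⟩

/-- The transformed right-hand side depends smoothly on all its arguments. -/
theorem IsRegularAt.smoothNear_newRhs {q : Q} (h : IsRegularAt T X U q) (s : ℝ) :
    SmoothNear (fun p : Q × ℝ => newRhs T X U p.1 p.2) (q, s) := by
  have hfst : ContDiff ℝ ∞ (fun p : Q × ℝ => p.1) := contDiff_fst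
  have h0 : ContDiff ℝ ∞ (fun p : Q × ℝ => p.1 0) :=
    (contDiff_apply ℝ ℝ (0 : Fin 4)).comp contDiff_fst
  have c := fun {f : Q → ℝ} (hf : SmoothNear f q) =>
    SmoothNear.comp (a := (q, s)) (g := fun p : Q × ℝ => p.1) hf hfst
  filter_upwards [c (h.smooth_U.pd 2), c (h.smooth_X.pd 2), c h.smooth_V, c (h.smooth_U.pd 0),
    c (h.smooth_X.pd 0),
    SmoothNear.comp (a := (q, s)) (g := fun p : Q × ℝ => p.1 0) h.smooth_T.deriv h0,
    hfst.continuous.continuousAt.eventually h.eventually] with p h1 h2 h3 h4 h5 h6 h7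
  exact (((h1.sub (h2.mul h3)).div h6 h7.deriv_T).mul contDiffAt_snd).add
    ((h4.sub (h5.mul h3)).div h6 h7.deriv_T)

theorem IsRegularAt.smoothNear_contactMap {z : J1} (h : IsRegularAt T X U z.toQ) :
    SmoothNear (contactMap T X U) z := by
  rw [smoothNear_pi]
  have h0 : ContDiff ℝ ∞ (fun y : J1 => y 0) := contDiff_apply ℝ ℝ (0 : Fin 5)
  have h3 : ContDiff ℝ ∞ (fun y : J1 => (y.toQ, y 3)) :=
    contDiff_J1_toQ.prodMk (contDiff_apply ℝ ℝ (3 : Fin 5))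
  intro i
  fin_cases i
  · exact SmoothNear.comp (f := T) (g := fun y : J1 => y 0) h.smooth_T h0
  · exact h.smooth_X.comp contDiff_J1_toQ
  · exact h.smooth_U.comp contDiff_J1_toQ
  · exact SmoothNear.comp (f := fun p : Q × ℝ => newRhs T X U p.1 p.2)
      (g := fun y : J1 => (y.toQ, y 3)) (h.smoothNear_newRhs (z 3)) h3
  · exact h.smooth_V.comp contDiff_J1_toQ

theorem IsRegularAt.fderiv_contactMap {z : J1} (h : IsRegularAt T X U z.toQ) (v : J1) :
    fderiv ℝ (contactMap T X U) z v 0 = deriv T (z 0) * v 0 ∧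
    fderiv ℝ (contactMap T X U) z v 1 = fderiv ℝ X z.toQ v.toQ ∧
    fderiv ℝ (contactMap T X U) z v 2 = fderiv ℝ U z.toQ v.toQ ∧
    fderiv ℝ (contactMap T X U) z v 4 = fderiv ℝ (V X U) z.toQ v.toQ := by
  simp only [fderiv_coord h.smoothNear_contactMap.differentiableAt]
  refine ⟨?_, fderiv_comp_J1_toQ h.smooth_X.differentiableAt v,
    fderiv_comp_J1_toQ h.smooth_U.differentiableAt v,
    fderiv_comp_J1_toQ h.smooth_V.differentiableAt v⟩
  have h0 : HasFDerivAt (fun y : J1 => y 0)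
      (ContinuousLinearMap.proj (R := ℝ) (φ := fun _ : Fin 5 => ℝ) 0) z := hasFDerivAt_apply 0 z
  have hT : HasDerivAt T (deriv T (z 0)) (z 0) := h.smooth_T.differentiableAt.hasDerivAt
  change fderiv ℝ (T ∘ fun y : J1 => y 0) z v = _
  rw [(hT.comp_hasFDerivAt z h0).fderiv]
  simp

theorem IsRegularAt.contactForm_map {z : J1} (h : IsRegularAt T X U z.toQ) (v : J1) :
    contactForm (contactMap T X U z) (fderiv ℝ (contactMap T X U) z v) =
      (pd 2 U z.toQ - pd 2 X z.toQ * V X U z.toQ) * contactForm z v := by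
  obtain ⟨h0, h1, h2, -⟩ := h.fderiv_contactMap v
  obtain ⟨hx, hux⟩ := h.contact.self_of_nhds
  have hT : deriv T (z 0) ≠ 0 := h.deriv_T
  have hP : contactMap T X U z 3 * deriv T (z 0) =
      (pd 2 U z.toQ - pd 2 X z.toQ * V X U z.toQ) * z 3 +
        (pd 0 U z.toQ - pd 0 X z.toQ * V X U z.toQ) := by
    change newRhs T X U z.toQ (z 3) * _ = _
    rw [newRhs]
    change ((_ / deriv T (z 0)) * _ + _ / deriv T (z 0)) * _ = _
    field_simp
  have h4 : contactMap T X U z 4 = V X U z.toQ := rfl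
  simp only [dx0] at hx
  simp only [contactForm, h0, h1, h2, h4, fderiv_eq_sum, Fin.sum_univ_four]
  have e0 : v.toQ 0 = v 0 := rfl
  have e1 : v.toQ 1 = v 1 := rfl
  have e2 : v.toQ 2 = v 2 := rfl
  have e3 : v.toQ 3 = v 4 := rfl
  have e4 : z.toQ 3 = z 4 := rfl
  rw [e4] at hx
  rw [e0, e1, e2, e3]
  linear_combination (-v 0) * hP + v 1 * hx + v 4 * hux

theorem IsRegularAt.isContactAt {z : J1} (h : IsRegularAt T X U z.toQ) :
    IsContactAt (contactMap T X U) z := by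
  refine isContactAt_of_smoothNear h.smoothNear_contactMap ?_
  filter_upwards [continuous_J1_toQ.continuousAt.eventually h.eventually] with y hy
  exact ⟨_, hy.factor, hy.contactForm_map⟩

/-- The contact form's differential evaluated at `∂_{u_x}` and `∂_x + u_x ∂_u`: the bracket of `V`
and `X` is the factor of the contact form. -/
theorem IsRegularAt.bracket {q : Q} (h : IsRegularAt T X U q) :
    pd 3 (V X U) q * dx0 X q - dx0 (V X U) q * pd 3 X q = pd 2 U q - pd 2 X q * V X U q := by
  obtain ⟨z, rfl⟩ : ∃ z : J1, z.toQ = q :=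
    ⟨![q 0, q 1, q 2, 0, q 3], by ext i; fin_cases i <;> rfl⟩
  obtain ⟨c, -, hθ, hω⟩ := exists_conformal_factor h.smoothNear_contactMap h.isContactAt.contact
  have hc : c = pd 2 U z.toQ - pd 2 X z.toQ * V X U z.toQ := by
    have := (hθ ![0, 0, 1, 0, 0]).symm.trans (h.contactForm_map _)
    simpa [contactForm] using this
  have := hω ![0, 0, 0, 0, 1] ![0, 1, z 4, 0, 0] (by simp [contactForm]) (by simp [contactForm])
  obtain ⟨a0, a1, -, a4⟩ := h.fderiv_contactMap ![0, 0, 0, 0, 1]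
  obtain ⟨b0, b1, -, b4⟩ := h.fderiv_contactMap ![0, 1, z 4, 0, 0]
  simp only [omega, a0, a1, a4, b0, b1, b4, fderiv_eq_sum, Fin.sum_univ_four, J1.toQ] at this
  simp at this
  rw [← hc, dx0, dx0]
  simp only [J1.toQ]
  simp
  linear_combination this

theorem fderiv_totX {F : Q → ℝ} (j : J2) :
    fderiv ℝ F (toJ1 j).toQ (totX j).toQ = Dx F (toK j) := by
  rw [fderiv_eq_sum, Fin.sum_univ_four]
  simp [totX, J1.toQ, Dx, dx0, toK, K.toQ, toJ1]
  ring

theorem IsRegularAt.totJac_contactMap {j : J2} (h : IsRegularAt T X U (toK j).toQ) :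
    totJac (contactMap T X U) j = deriv T (j 0) * Dx X (toK j) := by
  have h' : IsRegularAt T X U (toJ1 j).toQ := h
  obtain ⟨a0, a1, -, a4⟩ := h'.fderiv_contactMap (totT j)
  obtain ⟨b0, b1, -, b4⟩ := h'.fderiv_contactMap (totX j)
  rw [totJac, a0, b0, b1, fderiv_totX]
  simp [totT, totX, toJ1]

/-- The prolongation to `u_x` and `u_xx`. -/
theorem IsRegularAt.toK_of_isProlongation {j j' : J2} (h : IsRegularAt T X U (toK j).toQ)
    (hj : IsProlongation (contactMap T X U) j j') : toK j' = mapK T X U (toK j) := by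
  have h' : IsRegularAt T X U (toJ1 j).toQ := h
  obtain ⟨a0, a1, -, a4⟩ := h'.fderiv_contactMap (totT j)
  obtain ⟨b0, b1, -, b4⟩ := h'.fderiv_contactMap (totX j)
  have h7 := hj.uxx
  rw [h.totJac_contactMap, a0, b0, b4, fderiv_totX] at h7
  have hT : deriv T (j 0) ≠ 0 := h.deriv_T
  have h7' : j' 7 = Dx (V X U) (toK j) / Dx X (toK j) := by
    rw [h7]
    simp only [totT, totX, toJ1]
    simp
    rw [mul_div_mul_left _ _ hT]
  have hi : ∀ i, contactMap T X U (toJ1 j) i = toJ1 j' i := fun i => by rw [hj.1]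
  ext i
  fin_cases i
  · exact (hi 0).symm
  · exact (hi 1).symm
  · exact (hi 2).symm
  · exact (hi 4).symm
  · exact h7'

theorem IsContactData.eventually {k₀ : K} (h : IsContactData T X U k₀) :
    ∀ᶠ k in 𝓝 k₀, IsRegularAt T X U k.toQ ∧ Dx X k ≠ 0 :=
  (continuous_K_toQ.continuousAt.eventually h.isRegularAt.eventually).and
    (h.smooth_X.Dx.contDiffAt.continuousAt.eventually_ne h.defined)

theorem IsRegularAt.existsUnique_isProlongation {j : J2} (h : IsRegularAt T X U (toK j).toQ)
    (h0 : Dx X (toK j) ≠ 0) : ∃! j', IsProlongation (contactMap T X U) j j' := by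
  have h' : IsRegularAt T X U (toJ1 j).toQ := h
  refine EvolContact.existsUnique_isProlongation h'.isContactAt ?_
  rw [h.totJac_contactMap]
  exact mul_ne_zero h.deriv_T h0

theorem newRhs_eq_iff {q : Q} (h : IsRegularAt T X U q) {a b : ℝ} :
    newRhs T X U q a = newRhs T X U q b ↔ a = b := by
  rw [newRhs, newRhs, add_left_inj, mul_right_inj' (div_ne_zero h.factor h.deriv_T)]

/-! ### The induced map of the arguments of `H` is a local diffeomorphism -/

theorem IsRegularAt.smoothNear_mapK {k : K} (h : IsRegularAt T X U k.toQ) (h0 : Dx X k ≠ 0) :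
    SmoothNear (mapK T X U) k := by
  rw [smoothNear_pi]
  have hk0 : ContDiff ℝ ∞ (fun y : K => y 0) := contDiff_apply ℝ ℝ (0 : Fin 5)
  intro i
  fin_cases i
  · exact SmoothNear.comp (f := T) (g := fun y : K => y 0) h.smooth_T hk0
  · exact h.smooth_X.comp contDiff_K_toQ
  · exact h.smooth_U.comp contDiff_K_toQ
  · exact h.smooth_V.comp contDiff_K_toQ
  · filter_upwards [h.smooth_V.Dx, h.smooth_X.Dx,
      h.smooth_X.Dx.contDiffAt.continuousAt.eventually_ne h0] with p h1 h2 h3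
    exact h1.div h2 h3

theorem hasDerivAt_line {f : K → ℝ} {k : K} (h : DifferentiableAt ℝ f k) :
    HasDerivAt (fun s : ℝ => f (k + s • Pi.single 4 1)) (pd 4 f k) 0 :=
  h.hasFDerivAt.hasLineDerivAt _

theorem toQ_line (k : K) (s : ℝ) : (k + s • Pi.single 4 1 : K).toQ = k.toQ := by
  ext i; fin_cases i <;> simp [K.toQ]

theorem IsRegularAt.pd_uxx {k : K} (h : IsRegularAt T X U k.toQ) (h0 : Dx X k ≠ 0) :
    pd 4 (fun k => Dx (V X U) k / Dx X k) k =
      (pd 2 U k.toQ - pd 2 X k.toQ * V X U k.toQ) / Dx X k ^ 2 := by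
  have hlin : ∀ F : Q → ℝ, HasDerivAt (fun s : ℝ => Dx F (k + s • Pi.single 4 1))
      (pd 3 F k.toQ) 0 := by
    intro F
    have h1 : HasDerivAt (fun s : ℝ => dx0 F k.toQ + pd 3 F k.toQ * (k 4 + s))
        (pd 3 F k.toQ * 1) 0 := by
      refine HasDerivAt.const_add _ (HasDerivAt.const_mul _ ?_)
      exact (hasDerivAt_id (0 : ℝ)).const_add (k 4)
    rw [mul_one] at h1
    refine h1.congr_of_eventuallyEq (Filter.Eventually.of_forall fun s => ?_)
    simp only [Dx, toQ_line]
    simp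
  have hd : DifferentiableAt ℝ (fun k => Dx (V X U) k / Dx X k) k :=
    (h.smooth_V.Dx.contDiffAt.div h.smooth_X.Dx.contDiffAt h0).differentiableAt (by simp)
  have := (hasDerivAt_line hd).unique
    ((hlin (V X U)).fun_div (hlin X) (by simpa using h0))
  rw [this]
  simp only [zero_smul, add_zero]
  rw [← h.bracket, Dx, Dx]
  congr 1
  ring

theorem IsRegularAt.fderiv_mapK {k : K} (h : IsRegularAt T X U k.toQ) (h0 : Dx X k ≠ 0) (v : K) :
    fderiv ℝ (mapK T X U) k v 0 = deriv T (k 0) * v 0 ∧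
    fderiv ℝ (mapK T X U) k v 1 = fderiv ℝ X k.toQ v.toQ ∧
    fderiv ℝ (mapK T X U) k v 2 = fderiv ℝ U k.toQ v.toQ ∧
    fderiv ℝ (mapK T X U) k v 3 = fderiv ℝ (V X U) k.toQ v.toQ ∧
    fderiv ℝ (mapK T X U) k v 4 = fderiv ℝ (fun k => Dx (V X U) k / Dx X k) k v := by
  simp only [fderiv_coord (h.smoothNear_mapK h0).differentiableAt]
  refine ⟨?_, fderiv_comp_K_toQ h.smooth_X.differentiableAt v,
    fderiv_comp_K_toQ h.smooth_U.differentiableAt v,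
    fderiv_comp_K_toQ h.smooth_V.differentiableAt v, rfl⟩
  have hk0 : HasFDerivAt (fun y : K => y 0)
      (ContinuousLinearMap.proj (R := ℝ) (φ := fun _ : Fin 5 => ℝ) 0) k := hasFDerivAt_apply 0 k
  have hT : HasDerivAt T (deriv T (k 0)) (k 0) := h.smooth_T.differentiableAt.hasDerivAt
  change fderiv ℝ (T ∘ fun y : K => y 0) k v = _
  rw [(hT.comp_hasFDerivAt k hk0).fderiv]
  simp

theorem IsRegularAt.fderiv_mapK_single {k : K} (h : IsRegularAt T X U k.toQ) (h0 : Dx X k ≠ 0) :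
    fderiv ℝ (mapK T X U) k (Pi.single 4 1) =
      ((pd 2 U k.toQ - pd 2 X k.toQ * V X U k.toQ) / Dx X k ^ 2) • Pi.single 4 1 := by
  obtain ⟨a0, a1, a2, a3, a4⟩ := h.fderiv_mapK h0 (Pi.single 4 1)
  have hq : K.toQ (Pi.single 4 1) = 0 := by ext i; fin_cases i <;> simp [K.toQ]
  have a4' := a4.trans (h.pd_uxx h0)
  rw [hq, map_zero] at a1 a2 a3
  ext i
  fin_cases i
  · simpa using a0
  · simpa using a1
  · simpa using a2
  · simpa using a3
  · simpa using a4'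

theorem IsRegularAt.bijective_fderiv_mapK {k : K} (h : IsRegularAt T X U k.toQ)
    (h0 : Dx X k ≠ 0) : Function.Bijective (fderiv ℝ (mapK T X U) k) := by
  have hinj : Function.Injective (fderiv ℝ (mapK T X U) k : K →ₗ[ℝ] K) := by
    rw [injective_iff_map_eq_zero]
    intro v hv
    replace hv : fderiv ℝ (mapK T X U) k v = 0 := hv
    obtain ⟨a0, a1, a2, a3, -⟩ := h.fderiv_mapK h0 v
    have hT : deriv T (k 0) ≠ 0 := h.deriv_T
    obtain ⟨hx, hux⟩ := h.contact.self_of_nhds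
    have hb := h.bracket
    have hc := h.factor
    rw [hv, fderiv_eq_sum, Fin.sum_univ_four] at a1 a2 a3
    rw [hv] at a0
    have v0 : v 0 = 0 := by simpa [hT, eq_comm] using a0
    simp only [Pi.zero_apply, K.toQ, Matrix.cons_val_zero, v0] at a1 a2 a3
    simp only [dx0] at hx hb
    set q := k.toQ
    set c := pd 2 U q - pd 2 X q * V X U q with hcdef
    change 0 = 0 * pd 0 X q + v 1 * pd 1 X q + v 2 * pd 2 X q + v 3 * pd 3 X q at a1
    change 0 = 0 * pd 0 U q + v 1 * pd 1 U q + v 2 * pd 2 U q + v 3 * pd 3 U q at a2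
    change 0 = 0 * pd 0 (V X U) q + v 1 * pd 1 (V X U) q + v 2 * pd 2 (V X U) q
      + v 3 * pd 3 (V X U) q at a3
    have e2 : c * (v 2 - q 3 * v 1) = 0 := by
      rw [hcdef]
      linear_combination -a2 + V X U q * a1 - v 1 * hx - v 3 * hux
    have v2 : v 2 = q 3 * v 1 := by
      have := (mul_eq_zero.1 e2).resolve_left hc
      linarith
    rw [v2] at a1 a3
    have e1 : c * v 1 = 0 := by
      rw [← hb]
      linear_combination pd 3 X q * a3 - pd 3 (V X U) q * a1
    have v1 : v 1 = 0 := (mul_eq_zero.1 e1).resolve_left hc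
    have e3 : c * v 3 = 0 := by
      rw [← hb]
      linear_combination (pd 1 (V X U) q + pd 2 (V X U) q * q 3) * a1 -
        (pd 1 X q + pd 2 X q * q 3) * a3
    have v3 : v 3 = 0 := (mul_eq_zero.1 e3).resolve_left hc
    have hv4 : v = v 4 • Pi.single 4 1 := by
      ext i
      fin_cases i <;> simp [v0, v1, v2, v3]
    rw [hv4, map_smul, h.fderiv_mapK_single h0] at hv
    have := congrFun hv 4
    simp [h0] at this
    rw [hv4, this.resolve_right hc, zero_smul]
  exact ⟨hinj, LinearMap.injective_iff_surjective.1 hinj⟩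

/-! ### The explicit transformations are equivalence transformations -/

/-- Near the given point, the prolonged transformation of `(t, x, u, u_x, u_xx)` is a local
diffeomorphism. -/
theorem IsContactData.exists_chart {k₀ : K} (h : IsContactData T X U k₀) :
    ∃ e : OpenPartialHomeomorph K K, k₀ ∈ e.source ∧ (∀ k, e k = mapK T X U k) ∧
      (∀ k ∈ e.source, IsRegularAt T X U k.toQ ∧ Dx X k ≠ 0) ∧
      ∀ k ∈ e.target, ContDiffAt ℝ ∞ e.symm k := by
  have hder : ∀ k, IsRegularAt T X U k.toQ → Dx X k ≠ 0 →
      ∃ L : K ≃L[ℝ] K, HasFDerivAt (mapK T X U) (L : K →L[ℝ] K) k := by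
    intro k hk hk0
    have hb := hk.bijective_fderiv_mapK hk0
    refine ⟨ContinuousLinearEquiv.ofBijective (fderiv ℝ (mapK T X U) k)
      (LinearMap.ker_eq_bot.2 hb.1) (LinearMap.range_eq_top.2 hb.2), ?_⟩
    rw [ContinuousLinearEquiv.coe_ofBijective]
    exact (hk.smoothNear_mapK hk0).differentiableAt.hasFDerivAt
  obtain ⟨S, hS, hSo, hkS⟩ := eventually_nhds_iff.1 h.eventually
  have h₀ := hS k₀ hkS
  obtain ⟨L, hL⟩ := hder k₀ h₀.1 h₀.2
  have hsm := (h₀.1.smoothNear_mapK h₀.2).contDiffAt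
  refine ⟨(hsm.toOpenPartialHomeomorph _ hL (by simp)).restrOpen S hSo,
    ⟨hsm.mem_toOpenPartialHomeomorph_source hL (by simp), hkS⟩, fun k => rfl,
    fun k hk => hS k hk.2, fun k hk => ?_⟩
  have hk' := OpenPartialHomeomorph.map_target _ hk
  obtain ⟨hr, hd⟩ := hS _ hk'.2
  obtain ⟨L', hL'⟩ := hder _ hr hd
  exact OpenPartialHomeomorph.contDiffAt_symm _ hk hL' (hr.smoothNear_mapK hd).contDiffAt

/-- The derivatives `H_{u_xx}` of corresponding right-hand sides vanish simultaneously. -/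
theorem IsRegularAt.pd_rhs_ne_zero_iff {k : K} (h : IsRegularAt T X U k.toQ) (h0 : Dx X k ≠ 0)
    {f f' : K → ℝ} (hf : DifferentiableAt ℝ f k) (hf' : DifferentiableAt ℝ f' (mapK T X U k))
    (he : ∀ᶠ y in 𝓝 k, f' (mapK T X U y) = newRhs T X U y.toQ (f y)) :
    pd 4 f' (mapK T X U k) ≠ 0 ↔ pd 4 f k ≠ 0 := by
  have h1 : HasFDerivAt (fun y => f' (mapK T X U y)) _ k :=
    hf'.hasFDerivAt.comp k (h.smoothNear_mapK h0).differentiableAt.hasFDerivAt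
  have h2 := hasDerivAt_line h1.differentiableAt
  have h3 : HasDerivAt (fun s : ℝ => newRhs T X U k.toQ (f (k + s • Pi.single 4 1))) _ 0 :=
    ((hasDerivAt_line hf).const_mul
      ((pd 2 U k.toQ - pd 2 X k.toQ * V X U k.toQ) / deriv T (k.toQ 0))).add_const _
  have hline : Filter.Tendsto (fun s : ℝ => (k + s • Pi.single 4 1 : K)) (𝓝 0) (𝓝 k) := by
    have : Continuous (fun s : ℝ => (k + s • Pi.single 4 1 : K)) := by fun_prop
    simpa using this.tendsto 0
  have h4 := h2.unique (h3.congr_of_eventuallyEq ((hline.eventually he).mono fun s hs => by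
    simpa only [toQ_line] using hs))
  rw [pd, h1.fderiv, ContinuousLinearMap.comp_apply, h.fderiv_mapK_single h0, map_smul,
    smul_eq_mul] at h4
  change _ * pd 4 f' (mapK T X U k) = _ at h4
  have hA := div_ne_zero h.factor (pow_ne_zero 2 h0)
  have hB := div_ne_zero h.factor h.deriv_T
  refine not_congr ⟨fun h' => ?_, fun h' => ?_⟩
  · rw [h', mul_zero] at h4
    exact (mul_eq_zero.1 h4.symm).resolve_left hB
  · rw [h', mul_zero] at h4
    exact (mul_eq_zero.1 h4).resolve_left hA

/-- If `Φ` and `η` are given by the explicit formulas over `D`, then they transform `H` to any `H'`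
that is related to `H` by the explicit formula. -/
theorem transforms_of_formula {Φ : J1 → J1} {η : J2 × ℝ → ℝ} {D : Set (J2 × ℝ)} {S : Set K}
    {H H' : EvolEq} (hS : ∀ k ∈ S, IsRegularAt T X U k.toQ)
    (hD : ∀ y ∈ D, toK y.1 ∈ S ∧ (∀ᶠ z in 𝓝 (toJ1 y.1), Φ z = contactMap T X U z) ∧
      η y = newRhs T X U (K.toQ (toK y.1)) y.2)
    (hH : ∀ k ∈ S, (mapK T X U k ∈ H'.dom ↔ k ∈ H.dom) ∧
      (k ∈ H.dom → H'.rhs (mapK T X U k) = newRhs T X U k.toQ (H.rhs k))) :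
    Transforms Φ η D H H' := by
  have key : ∀ j h j', (j, h) ∈ D → IsProlongation Φ j j' →
      (H.OnGraph j h ↔ H'.OnGraph j' (newRhs T X U (K.toQ (toK j)) h)) ∧
      j' 3 = newRhs T X U (K.toQ (toK j)) (j 3) := by
    intro j h j' hjD hp
    obtain ⟨hjS, hΦ, -⟩ := hD _ hjD
    have hr := hS _ hjS
    have hp' := hp.congr (hΦ.mono fun z hz => hz.symm)
    refine ⟨?_, congrFun hp'.1.symm 3⟩
    rw [EvolEq.OnGraph, EvolEq.OnGraph, hr.toK_of_isProlongation hp', (hH _ hjS).1]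
    refine and_congr_right fun hdom => ?_
    rw [(hH _ hjS).2 hdom, newRhs_eq_iff hr]
  constructor
  · intro j h j' hjD hp
    rw [(hD _ hjD).2.2]
    exact (key j h j' hjD hp).1
  · intro j j' hjD hp
    obtain ⟨h1, h2⟩ := key j _ j' hjD hp
    change H.OnGraph j (j 3) ↔ H'.OnGraph j' (j' 3)
    rw [h1, h2]

/-- A neighbourhood over which the hypotheses of `transforms_of_formula` are satisfied. -/
theorem exists_mem_nhds_formula {Φ : J1 → J1} {η : J2 × ℝ → ℝ} {j₀ : J2} {S : Set K}
    (hS : S ∈ 𝓝 (toK j₀)) (hΦ : ∀ᶠ z in 𝓝 (toJ1 j₀), Φ z = contactMap T X U z)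
    (hη : ∀ᶠ y in 𝓝 (j₀, j₀ 3), η y = newRhs T X U (K.toQ (toK y.1)) y.2) :
    ∃ D ∈ 𝓝 (j₀, j₀ 3), ∀ y ∈ D, toK y.1 ∈ S ∧
      (∀ᶠ z in 𝓝 (toJ1 y.1), Φ z = contactMap T X U z) ∧
      η y = newRhs T X U (K.toQ (toK y.1)) y.2 := by
  have h1 : ContinuousAt (fun y : J2 × ℝ => toK y.1) (j₀, j₀ 3) :=
    (continuous_toK.comp continuous_fst).continuousAt
  have h2 : ContinuousAt (fun y : J2 × ℝ => toJ1 y.1) (j₀, j₀ 3) :=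
    (continuous_toJ1.comp continuous_fst).continuousAt
  exact ⟨_, (h1.eventually hS).and ((h2.eventually (eventually_eventually_nhds.2 hΦ)).and hη),
    fun y hy => hy⟩

theorem IsContactData.isEquivalence {Φ : J1 → J1} {η : J2 × ℝ → ℝ} {j₀ : J2}
    (h : IsContactData T X U (toK j₀))
    (hΦ : ∀ᶠ z in 𝓝 (toJ1 j₀), Φ z = contactMap T X U z)
    (hη : ∀ᶠ y in 𝓝 (j₀, j₀ 3), η y = newRhs T X U (K.toQ (toK y.1)) y.2) :
    IsEquivalence Φ η j₀ := by
  have hr := h.isRegularAt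
  have hr' : IsRegularAt T X U (toJ1 j₀).toQ := hr
  refine ⟨hr'.isContactAt.congr hΦ, ?_, ?_, ?_, ?_⟩
  · obtain ⟨j', hj', -⟩ := hr.existsUnique_isProlongation h.defined
    exact ⟨j', hj'.congr hΦ⟩
  · refine SmoothNear.congr ?_ hη
    refine SmoothNear.comp (f := fun p : Q × ℝ => newRhs T X U p.1 p.2)
      (g := fun y : J2 × ℝ => ((toK y.1).toQ, y.2)) (hr.smoothNear_newRhs (j₀ 3)) ?_
    have hK : ContDiff ℝ ∞ toK := by
      refine contDiff_pi.2 fun i => ?_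
      fin_cases i <;> exact contDiff_apply ℝ ℝ _
    exact ((contDiff_K_toQ.comp hK).comp contDiff_fst).prodMk contDiff_snd
  · have hc : Filter.Tendsto (fun s : ℝ => (j₀, s)) (𝓝 (j₀ 3)) (𝓝 (j₀, j₀ 3)) :=
      (Continuous.prodMk_right j₀).tendsto _
    have h3 : HasDerivAt (fun s : ℝ => newRhs T X U (toK j₀).toQ s) _ (j₀ 3) :=
      ((hasDerivAt_id (j₀ 3)).const_mul ((pd 2 U (toK j₀).toQ - pd 2 X (toK j₀).toQ *
        V X U (toK j₀).toQ) / deriv T ((toK j₀).toQ 0))).add_const _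
    rw [(h3.congr_of_eventuallyEq (hc.eventually hη)).deriv, mul_one]
    exact div_ne_zero hr.factor hr.deriv_T
  · obtain ⟨e, he0, hee, hreg, hsymm⟩ := h.exists_chart
    have hinv : ∀ k ∈ e.source, e.symm (mapK T X U k) = k := fun k hk => by
      rw [← hee, e.left_inv hk]
    have hinv' : ∀ k ∈ e.target, mapK T X U (e.symm k) = k := fun k hk => by
      rw [← hee, e.right_inv hk]
    obtain ⟨D, hDn, hD⟩ := exists_mem_nhds_formula (e.open_source.mem_nhds he0) hΦ hη
    refine ⟨D, hDn, fun H => ?_, fun H' => ?_⟩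
    · -- the transformed right-hand side, expressed in the new coordinates
      have hsm : ∀ k ∈ e.target ∩ e.symm ⁻¹' H.dom, ContDiffAt ℝ ∞
          (fun k => newRhs T X U (e.symm k).toQ (H.rhs (e.symm k))) k := by
        intro k hk
        have h1 := hsymm k hk.1
        have h2 : ContDiffAt ℝ ∞ (fun k => H.rhs (e.symm k)) k :=
          ContDiffAt.comp k (H.smooth.contDiffAt (H.isOpen_dom.mem_nhds hk.2)) h1
        have h3 : ContDiffAt ℝ ∞ (fun k => (e.symm k).toQ) k :=
          ContDiffAt.comp k contDiff_K_toQ.contDiffAt h1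
        exact ContDiffAt.comp (g := fun p : Q × ℝ => newRhs T X U p.1 p.2) k
          ((hreg _ (e.map_target hk.1)).1.smoothNear_newRhs _).contDiffAt (h3.prodMk h2)
      refine ⟨⟨e.target ∩ e.symm ⁻¹' H.dom, e.isOpen_inter_preimage_symm H.isOpen_dom,
        fun k => newRhs T X U (e.symm k).toQ (H.rhs (e.symm k)),
        fun k hk => (hsm k hk).contDiffWithinAt, fun k hk => ?_⟩, ?_⟩
      · have hs := e.map_target hk.1
        obtain ⟨hrk, hdk⟩ := hreg _ hs
        have hkk := hinv' k hk.1
        rw [← hkk]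
        refine (hrk.pd_rhs_ne_zero_iff hdk ((H.smooth.contDiffAt
          (H.isOpen_dom.mem_nhds hk.2)).differentiableAt (by simp)) ?_ ?_).2 (H.nondeg _ hk.2)
        · rw [hkk]
          exact (hsm k hk).differentiableAt (by simp)
        · filter_upwards [e.open_source.mem_nhds hs] with y hy
          rw [hinv y hy]
      · refine transforms_of_formula (fun k hk => (hreg k hk).1) hD fun k hk => ⟨?_, fun _ => ?_⟩
        · have : mapK T X U k ∈ e.target := hee k ▸ e.map_source hk
          simp [this, hinv k hk]
        · simp only [hinv k hk]
    · -- the original right-hand side is obtained by solving the formula for `H`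
      set a : Q → ℝ := fun q =>
        (pd 2 U q - pd 2 X q * V X U q) / deriv T (q 0) with ha
      set b : Q → ℝ := fun q =>
        (pd 0 U q - pd 0 X q * V X U q) / deriv T (q 0) with hb
      have hnew : ∀ q s, newRhs T X U q s = a q * s + b q := fun q s => rfl
      have ha0 : ∀ k ∈ e.source, a k.toQ ≠ 0 := fun k hk =>
        div_ne_zero (hreg k hk).1.factor (hreg k hk).1.deriv_T
      have hab : ∀ k ∈ e.source, ContDiffAt ℝ ∞ (fun k : K => a k.toQ) k ∧
          ContDiffAt ℝ ∞ (fun k : K => b k.toQ) k := by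
        intro k hk
        obtain ⟨hrk, -⟩ := hreg k hk
        have c := fun {f : Q → ℝ} (hf : SmoothNear f k.toQ) =>
          (SmoothNear.comp (a := k) hf contDiff_K_toQ).contDiffAt
        have hk0 : ContDiffAt ℝ ∞ (fun y : K => deriv T (y 0)) k :=
          (SmoothNear.comp (a := k) (g := fun y : K => y 0) hrk.smooth_T.deriv
            (contDiff_apply ℝ ℝ (0 : Fin 5))).contDiffAt
        exact ⟨((c (hrk.smooth_U.pd 2)).sub ((c (hrk.smooth_X.pd 2)).mul
            (c hrk.smooth_V))).div hk0 hrk.deriv_T,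
          ((c (hrk.smooth_U.pd 0)).sub ((c (hrk.smooth_X.pd 0)).mul
            (c hrk.smooth_V))).div hk0 hrk.deriv_T⟩
      have hopen : IsOpen (e.source ∩ mapK T X U ⁻¹' H'.dom) := by
        have := e.isOpen_inter_preimage H'.isOpen_dom
        have he : (e : K → K) = mapK T X U := funext hee
        rwa [he] at this
      have hsm : ∀ k ∈ e.source ∩ mapK T X U ⁻¹' H'.dom, ContDiffAt ℝ ∞
          (fun k => (H'.rhs (mapK T X U k) - b k.toQ) / a k.toQ) k := by
        intro k hk
        obtain ⟨hrk, hdk⟩ := hreg k hk.1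
        have h1 : ContDiffAt ℝ ∞ (fun k => H'.rhs (mapK T X U k)) k :=
          ContDiffAt.comp k (H'.smooth.contDiffAt (H'.isOpen_dom.mem_nhds hk.2))
            (hrk.smoothNear_mapK hdk).contDiffAt
        exact (h1.sub (hab k hk.1).2).div (hab k hk.1).1 (ha0 k hk.1)
      have hform : ∀ k ∈ e.source, H'.rhs (mapK T X U k) =
          newRhs T X U k.toQ ((H'.rhs (mapK T X U k) - b k.toQ) / a k.toQ) := by
        intro k hk
        have := ha0 k hk
        rw [hnew]
        field_simp
        ring
      refine ⟨⟨e.source ∩ mapK T X U ⁻¹' H'.dom, hopen,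
        fun k => (H'.rhs (mapK T X U k) - b k.toQ) / a k.toQ,
        fun k hk => (hsm k hk).contDiffWithinAt, fun k hk => ?_⟩, ?_⟩
      · obtain ⟨hrk, hdk⟩ := hreg _ hk.1
        refine (hrk.pd_rhs_ne_zero_iff hdk ((hsm k hk).differentiableAt (by simp))
          ((H'.smooth.contDiffAt (H'.isOpen_dom.mem_nhds hk.2)).differentiableAt (by simp)) ?_).1
          (H'.nondeg _ hk.2)
        filter_upwards [e.open_source.mem_nhds hk.1] with y hy using hform y hy
      · exact transforms_of_formula (fun k hk => (hreg k hk).1) hD fun k hk =>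
          ⟨⟨fun h => ⟨hk, h⟩, fun h => h.2⟩, fun _ => hform k hk⟩

end Explicit

/-! ### Admissible transformations: `T` depends on `t` only -/

theorem EvolEq.contDiffAt (H : EvolEq) {k : K} (hk : k ∈ H.dom) : ContDiffAt ℝ ∞ H.rhs k :=
  H.smooth.contDiffAt (H.isOpen_dom.mem_nhds hk)

/-- The properties of an admissible transformation that are used at jets near the given one. -/
structure IsAdmissibleNear (H H' : EvolEq) (Φ : J1 → J1) (j : J2) : Prop where
  contact : IsContactAt Φ (toJ1 j)
  jac : totJac Φ j ≠ 0
  maps : ∀ j', IsProlongation Φ j j' → (j ∈ H.manifold ↔ j' ∈ H'.manifold)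

theorem IsAdmissible.eventually {H H' : EvolEq} {Φ : J1 → J1} {j₀ : J2}
    (h : IsAdmissible H H' Φ j₀) : ∀ᶠ j in 𝓝 j₀, IsAdmissibleNear H H' Φ j := by
  obtain ⟨j', hj'⟩ := h.defined
  have h0 := (isProlongation_iff.1 hj').2.1
  filter_upwards [continuous_toJ1.continuousAt.eventually h.contact.eventually,
    (continuousAt_totJac h.contact.smooth).eventually_ne h0, h.maps] with j h1 h2 h3
  exact ⟨h1, h2, h3⟩

/-- On the manifold of the equation, `D_x T = 0`. Along the line in the direction of `u_tt` through
a jet of the manifold, all transformed coordinates `t, x, u, u_t, u_x` are constant, and since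
`H'_{u_xx} ≠ 0`, so is the transformed `u_xx`. Thus the images of the vectors
`T_{u_t} D_x - (D_x T) ∂_{u_t}` and `(D_t T) D_x - (D_x T) D_t` are skew-orthogonal for `omega`,
while their product is `(D_x T)^2` up to a nonzero factor. -/
theorem fderiv_totX_eq_zero {H H' : EvolEq} {Φ : J1 → J1} {j : J2}
    (h : ∀ᶠ i in 𝓝 j, IsAdmissibleNear H H' Φ i) (hj : j ∈ H.manifold) :
    fderiv ℝ Φ (toJ1 j) (totX j) 0 = 0 := by
  have h₀ := h.self_of_nhds
  set l : ℝ → J2 := fun s => j + s • Pi.single 5 1 with hl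
  have hlc : Continuous l := by fun_prop
  have hl0 : l 0 = j := by simp [hl]
  have hl1 : ∀ s, toJ1 (l s) = toJ1 j := fun s => by
    ext i; fin_cases i <;> simp [hl, toJ1]
  have hlK : ∀ s, toK (l s) = toK j := fun s => by
    ext i; fin_cases i <;> simp [hl, toK]
  have hlX : ∀ s, totX (l s) = totX j := fun s => by
    ext i; fin_cases i <;> simp [hl, totX]
  have hlT : ∀ s, totT (l s) = totT j + s • Pi.single 3 1 := fun s => by
    ext i; fin_cases i <;> simp [hl, totT]
  have hl3 : ∀ s, l s 3 = j 3 := fun s => by simp [hl]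
  have hlM : ∀ s, l s ∈ H.manifold := fun s => by
    change toK (l s) ∈ H.dom ∧ l s 3 = H.rhs (toK (l s))
    rw [hlK, hl3]
    exact hj
  -- the transformed value of `u_xx`
  set ψ : J2 → ℝ := fun i => (fderiv ℝ Φ (toJ1 i) (totT i) 0 * fderiv ℝ Φ (toJ1 i) (totX i) 4 -
      fderiv ℝ Φ (toJ1 i) (totT i) 4 * fderiv ℝ Φ (toJ1 i) (totX i) 0) / totJac Φ i with hψ
  have hs := h₀.contact.smooth
  have hψc : ContinuousAt (fun s => ψ (l s)) 0 := by
    have : ContinuousAt ψ (l 0) := by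
      rw [hl0]
      exact (((continuousAt_fderiv_total hs continuous_totT 0).mul
        (continuousAt_fderiv_total hs continuous_totX 4)).sub
        ((continuousAt_fderiv_total hs continuous_totT 4).mul
        (continuousAt_fderiv_total hs continuous_totX 0))).div (continuousAt_totJac hs) h₀.jac
    exact ContinuousAt.comp (f := l) this hlc.continuousAt
  set y := Φ (toJ1 j) with hy
  set κ : ℝ → K := fun r => ![y 0, y 1, y 2, y 4, r] with hκ
  have himg : ∀ s, IsAdmissibleNear H H' Φ (l s) →
      κ (ψ (l s)) ∈ H'.dom ∧ y 3 = H'.rhs (κ (ψ (l s))) := by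
    intro s hsG
    obtain ⟨j', hj', -⟩ := existsUnique_isProlongation hsG.contact hsG.jac
    have hmem := (hsG.maps j' hj').1 (hlM s)
    have hyi : ∀ i, y i = toJ1 j' i := fun i => by rw [← hj'.1, hl1]
    have hK : toK j' = κ (ψ (l s)) := by
      ext i
      fin_cases i
      · exact (hyi 0).symm
      · exact (hyi 1).symm
      · exact (hyi 2).symm
      · exact (hyi 4).symm
      · exact hj'.uxx
    have h3 : y 3 = j' 3 := hyi 3
    rw [h3, ← hK]
    exact hmem
  have hev : ∀ᶠ s in 𝓝 (0 : ℝ), IsAdmissibleNear H H' Φ (l s) :=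
    hlc.continuousAt.eventually (by rwa [hl0])
  obtain ⟨hdom, hval⟩ := himg 0 hev.self_of_nhds
  have hne := (hasDerivAt_line ((H'.contDiffAt hdom).differentiableAt
    (by simp))).eventually_ne (c := y 3) (H'.nondeg _ hdom)
  rw [eventually_nhdsWithin_iff] at hne
  have htend : Filter.Tendsto (fun s => ψ (l s) - ψ (l 0)) (𝓝 0) (𝓝 0) := by
    have := (hψc.sub continuousAt_const).tendsto (x := 0) (f := fun s => ψ (l s) - ψ (l 0))
    simpa using this
  have hconst : ∀ᶠ s in 𝓝 (0 : ℝ), ψ (l s) = ψ (l 0) ∧ IsAdmissibleNear H H' Φ (l s) := by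
    filter_upwards [hev, htend.eventually hne] with s hs1 hs2
    refine ⟨?_, hs1⟩
    by_contra hcon
    refine hs2 (sub_ne_zero.2 hcon) ?_
    rw [(himg s hs1).2]
    congr 1
    ext i
    fin_cases i <;> simp [hκ]
  obtain ⟨s, ⟨hs1, hsG⟩, hs0⟩ := ((hconst.filter_mono nhdsWithin_le_nhds).and
    (self_mem_nhdsWithin : {(0 : ℝ)}ᶜ ∈ 𝓝[≠] 0)).exists
  replace hs0 : s ≠ 0 := hs0
  have hD0 := h₀.jac
  have hDs := hsG.jac
  rw [hl0, hψ] at hs1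
  simp only [totJac, hl1, hlX, hlT, map_add, map_smul, Pi.add_apply, Pi.smul_apply,
    smul_eq_mul] at hs1 hD0 hDs
  rw [div_eq_div_iff hDs hD0] at hs1
  obtain ⟨c, hc0, -, hω⟩ := exists_conformal_factor hs h₀.contact.contact
  have e3 : contactForm (toJ1 j) (Pi.single 3 1) = 0 := by simp [contactForm]
  have w1 := hω _ _ e3 (contactForm_totT j)
  have w2 := hω _ _ e3 (contactForm_totX j)
  have w3 := hω _ _ (contactForm_totT j) (contactForm_totX j)
  have c1 : omega (Pi.single 3 1) (totT j) = 1 := by simp [omega, totT]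
  have c2 : omega (Pi.single 3 1) (totX j) = 0 := by simp [omega, totX]
  have c3 : omega (totT j) (totX j) = 0 := by simp [omega, totT, totX]
  rw [c1] at w1
  rw [c2] at w2
  rw [c3] at w3
  simp only [omega] at w1 w2 w3
  set a := fderiv ℝ Φ (toJ1 j) (totT j)
  set b := fderiv ℝ Φ (toJ1 j) (totX j)
  set d := fderiv ℝ Φ (toJ1 j) (Pi.single 3 1)
  have key : (s * c) * b 0 ^ 2 = 0 := by
    linear_combination hs1 - s * b 0 ^ 2 * w1 + s * a 0 * b 0 * w2 - s * d 0 * b 0 * w3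
  simpa [hs0, hc0] using key

/-- The points of the manifold of an equation, parametrized by `(t, x, u, u_x, u_xx)`, project onto
a neighbourhood in the space of first-order jets, since `H_{u_xx} ≠ 0`. -/
theorem EvolEq.eventually_of_graph (H : EvolEq) {j₀ : J2} (hj : j₀ ∈ H.manifold) {P : J1 → Prop}
    (h : ∀ᶠ k in 𝓝 (toK j₀), P ![k 0, k 1, k 2, H.rhs k, k 3]) :
    ∀ᶠ z in 𝓝 (toJ1 j₀), P z := by
  set F : K → J1 := fun k => ![k 0, k 1, k 2, H.rhs k, k 3] with hF
  obtain ⟨hdom, hval⟩ := hj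
  have hFc : ContDiffAt ℝ ∞ F (toK j₀) := by
    refine contDiffAt_pi.2 fun i => ?_
    fin_cases i
    · exact (contDiff_apply ℝ ℝ (0 : Fin 5)).contDiffAt
    · exact (contDiff_apply ℝ ℝ (1 : Fin 5)).contDiffAt
    · exact (contDiff_apply ℝ ℝ (2 : Fin 5)).contDiffAt
    · exact H.contDiffAt hdom
    · exact (contDiff_apply ℝ ℝ (3 : Fin 5)).contDiffAt
  have hFd : DifferentiableAt ℝ F (toK j₀) := hFc.differentiableAt (by simp)
  have hcoord : ∀ (i : Fin 5) v, fderiv ℝ (fun y : K => y i) (toK j₀) v = v i := fun i v => by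
    rw [(hasFDerivAt_apply i (toK j₀)).fderiv]
    rfl
  have hsurj : LinearMap.range (fderiv ℝ F (toK j₀) : K →ₗ[ℝ] J1) = ⊤ := by
    rw [LinearMap.range_eq_top]
    intro w
    have hnd := H.nondeg _ hdom
    set v : K := ![w 0, w 1, w 2, w 4, 0]
    set r := (w 3 - fderiv ℝ H.rhs (toK j₀) v) / pd 4 H.rhs (toK j₀) with hr
    have hdH : fderiv ℝ H.rhs (toK j₀) (v + r • Pi.single 4 1) = w 3 := by
      rw [map_add, map_smul, smul_eq_mul]
      change _ + r * pd 4 H.rhs (toK j₀) = _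
      rw [hr]
      field_simp
      ring
    refine ⟨v + r • Pi.single 4 1, ?_⟩
    change fderiv ℝ F (toK j₀) _ = w
    ext i
    rw [fderiv_coord hFd]
    fin_cases i
    · refine (hcoord 0 _).trans ?_
      simp [v]
    · refine (hcoord 1 _).trans ?_
      simp [v]
    · refine (hcoord 2 _).trans ?_
      simp [v]
    · exact hdH
    · refine (hcoord 3 _).trans ?_
      simp [v]
  have hmap := (hFc.hasStrictFDerivAt (by simp)).map_nhds_eq_of_surj hsurj
  have hF0 : F (toK j₀) = toJ1 j₀ := by
    ext i
    fin_cases i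
    · rfl
    · rfl
    · rfl
    · exact hval.symm
    · rfl
  rw [← hF0, ← hmap]
  exact h

/-- A function of first-order jets that does not depend on `u_t` near `z₀`, as a function of
`(t, x, u, u_x)`. -/
theorem exists_factor_toQ {f : J1 → ℝ} {z₀ : J1} (hf : SmoothNear f z₀)
    (h : ∀ᶠ z in 𝓝 z₀, pd 3 f z = 0) :
    ∃ g : Q → ℝ, SmoothNear g z₀.toQ ∧ ∀ᶠ z in 𝓝 z₀, f z = g z.toQ ∧
      ∀ v, fderiv ℝ f z v = fderiv ℝ g z.toQ v.toQ := by
  set ι : Q → J1 := fun q => ![q 0, q 1, q 2, z₀ 3, q 3] with hι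
  have hιc : ContDiff ℝ ∞ ι := by
    refine contDiff_pi.2 fun i => ?_
    fin_cases i
    · exact contDiff_apply ℝ ℝ (0 : Fin 4)
    · exact contDiff_apply ℝ ℝ (1 : Fin 4)
    · exact contDiff_apply ℝ ℝ (2 : Fin 4)
    · exact contDiff_const
    · exact contDiff_apply ℝ ℝ (3 : Fin 4)
  have hι0 : ι z₀.toQ = z₀ := by ext i; fin_cases i <;> rfl
  have hg : SmoothNear (fun q => f (ι q)) z₀.toQ :=
    SmoothNear.comp (f := f) (g := ι) (by rwa [hι0]) hιc
  have heq : ∀ᶠ z in 𝓝 z₀, f z = f (ι z.toQ) := by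
    filter_upwards [eventually_eq_of_pd_eq_zero (fun i => i = 3) hf (by rintro i rfl; exact h)]
      with z hz
    rw [hz]
    congr 1
    ext i
    fin_cases i <;> rfl
  refine ⟨_, hg, ?_⟩
  filter_upwards [eventually_eventually_nhds.2 heq,
    continuous_J1_toQ.continuousAt.eventually hg.eventually] with z hz hgz
  refine ⟨hz.self_of_nhds, fun v => ?_⟩
  rw [Filter.EventuallyEq.fderiv_eq hz]
  exact fderiv_comp_J1_toQ (f := fun q => f (ι q)) hgz.differentiableAt v

/-- A function of `(t, x, u, u_x)` whose total derivative `D_x` vanishes depends on `t` only. -/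
theorem exists_factor_time {g : Q → ℝ} {k₀ : K} (hg : SmoothNear g k₀.toQ)
    (h : ∀ᶠ k in 𝓝 k₀, Dx g k = 0) :
    ∃ T : ℝ → ℝ, SmoothNear T (k₀ 0) ∧ ∀ᶠ q in 𝓝 k₀.toQ, g q = T (q 0) := by
  have hsplit : ∀ᶠ q in 𝓝 k₀.toQ, dx0 g q = 0 ∧ pd 3 g q = 0 := by
    set σ : Q × ℝ → K := fun p => ![p.1 0, p.1 1, p.1 2, p.1 3, p.2] with hσ
    have hσc : Continuous σ := by fun_prop
    have hσ0 : σ (k₀.toQ, k₀ 4) = k₀ := by ext i; fin_cases i <;> rfl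
    have h' : ∀ᶠ p in 𝓝 (k₀.toQ, k₀ 4), Dx g (σ p) = 0 :=
      hσc.continuousAt.eventually (by rwa [hσ0])
    filter_upwards [h'.curry_nhds] with q hq
    refine affine_eq_zero (hq.mono fun s hs => ?_)
    have hσq : (σ (q, s)).toQ = q := by ext i; fin_cases i <;> rfl
    rw [Dx, hσq] at hs
    exact hs
  have h2 : ∀ᶠ q in 𝓝 k₀.toQ, pd 2 g q = 0 := by
    filter_upwards [eventually_eventually_nhds.2 hsplit, hg] with q hq hgq
    have hz : ∀ i : Fin 4, pd 3 (pd i g) q = 0 := by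
      intro i
      rw [pd_comm 3 i hgq, pd, Filter.EventuallyEq.fderiv_eq (f := fun _ => 0)
        (hq.mono fun y hy => hy.2)]
      simp
    have hd : ∀ i : Fin 4, HasFDerivAt (pd i g) (fderiv ℝ (pd i g) q) q := fun i =>
      ((contDiffAt_pd i hgq).differentiableAt (by simp)).hasFDerivAt
    have hder : HasFDerivAt (dx0 g) _ q :=
      (hd 1).add ((hd 2).mul (hasFDerivAt_apply (3 : Fin 4) q))
    have h0 : HasFDerivAt (dx0 g) (0 : Q →L[ℝ] ℝ) q :=
      (hasFDerivAt_const (0 : ℝ) q).congr_of_eventuallyEq (hq.mono fun y hy => hy.1)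
    have := congrArg (fun L : Q →L[ℝ] ℝ => L (Pi.single 3 1)) (hder.unique h0)
    have h1 : fderiv ℝ (pd 1 g) q (Pi.single 3 1) = 0 := hz 1
    have h2 : fderiv ℝ (pd 2 g) q (Pi.single 3 1) = 0 := hz 2
    simpa [h1, h2] using this
  have hall : ∀ i : Fin 4, i ≠ 0 → ∀ᶠ q in 𝓝 k₀.toQ, pd i g q = 0 := by
    intro i hi
    fin_cases i
    · exact absurd rfl hi
    · filter_upwards [hsplit, h2] with q hq hq2
      have := hq.1
      rw [dx0, hq2] at this
      simpa using this
    · exact h2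
    · exact hsplit.mono fun q hq => hq.2
  set τ : ℝ → Q := fun s => ![s, k₀ 1, k₀ 2, k₀ 3] with hτ
  have hτc : ContDiff ℝ ∞ τ := by
    refine contDiff_pi.2 fun i => ?_
    fin_cases i
    · exact contDiff_id
    all_goals exact contDiff_const
  have hτ0 : τ (k₀ 0) = k₀.toQ := rfl
  refine ⟨fun s => g (τ s), SmoothNear.comp (f := g) (g := τ) (by rwa [hτ0]) hτc, ?_⟩
  filter_upwards [eventually_eq_of_pd_eq_zero (fun i => i ≠ 0) hg hall] with q hq
  rw [hq]
  congr 1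
  ext i
  fin_cases i <;> rfl

theorem IsAdmissible.exists_time {H H' : EvolEq} {Φ : J1 → J1} {j₀ : J2}
    (h : IsAdmissible H H' Φ j₀) :
    ∃ T : ℝ → ℝ, SmoothNear T (j₀ 0) ∧ ∀ᶠ z in 𝓝 (toJ1 j₀), Φ z 0 = T (z 0) := by
  obtain ⟨hdom, hval⟩ := h.mem
  set F : K → J1 := fun k => ![k 0, k 1, k 2, H.rhs k, k 3] with hF
  set J : K × ℝ → J2 := fun p =>
    ![p.1 0, p.1 1, p.1 2, H.rhs p.1, p.1 3, j₀ 5, p.2, p.1 4] with hJ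
  have hH : ContinuousAt H.rhs (toK j₀) := (H.contDiffAt hdom).continuousAt
  have hJ0 : J (toK j₀, j₀ 6) = j₀ := by
    ext i
    fin_cases i
    · rfl
    · rfl
    · rfl
    · exact hval.symm
    · rfl
    · rfl
    · rfl
    · rfl
  have hJc : ContinuousAt J (toK j₀, j₀ 6) := by
    have hfst : ∀ i : Fin 5, ContinuousAt (fun p : K × ℝ => p.1 i) (toK j₀, j₀ 6) := fun i =>
      ((continuous_apply i).comp continuous_fst).continuousAt
    refine continuousAt_pi.2 fun i => ?_
    fin_cases i
    · exact hfst 0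
    · exact hfst 1
    · exact hfst 2
    · exact ContinuousAt.comp (f := fun p : K × ℝ => p.1) hH continuous_fst.continuousAt
    · exact hfst 3
    · exact continuousAt_const
    · exact continuous_snd.continuousAt
    · exact hfst 4
  have hFJ : ∀ k r, toJ1 (J (k, r)) = F k := fun k r => by ext i; fin_cases i <;> rfl
  have hKJ : ∀ k r, toK (J (k, r)) = k := fun k r => by ext i; fin_cases i <;> rfl
  have hF0 : F (toK j₀) = toJ1 j₀ := by rw [← hFJ _ (j₀ 6), hJ0]
  have hFc : ContinuousAt F (toK j₀) := by
    have h1 : ContinuousAt (fun k : K => J (k, j₀ 6)) (toK j₀) :=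
      ContinuousAt.comp (f := fun k : K => (k, j₀ 6)) hJc (by fun_prop)
    have := continuous_toJ1.continuousAt.comp h1
    exact this
  -- `D_x T` vanishes on the manifold, where `u_tx` is free
  have hlin : ∀ᶠ k in 𝓝 (toK j₀), pd 3 (fun z => Φ z 0) (F k) = 0 ∧
      ∀ r, fderiv ℝ (fun z => Φ z 0) (F k) ![0, 1, k 3, r, k 4] = 0 := by
    have hev : ∀ᶠ p in 𝓝 (toK j₀, j₀ 6), ∀ᶠ i in 𝓝 (J p), IsAdmissibleNear H H' Φ i :=
      hJc.eventually (by rw [hJ0]; exact eventually_eventually_nhds.2 h.eventually)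
    filter_upwards [hev.curry_nhds, H.isOpen_dom.mem_nhds hdom] with k hk hkd
    have hzero : ∀ᶠ r in 𝓝 (j₀ 6),
        fderiv ℝ (fun z => Φ z 0) (F k) ![0, 1, k 3, r, k 4] = 0 := by
      filter_upwards [hk] with r hr
      have hmem : J (k, r) ∈ H.manifold := by
        change toK (J (k, r)) ∈ H.dom ∧ H.rhs k = H.rhs (toK (J (k, r)))
        rw [hKJ]
        exact ⟨hkd, rfl⟩
      have := fderiv_totX_eq_zero hr hmem
      rw [hFJ, fderiv_coord (hFJ k r ▸ hr.self_of_nhds.contact.smooth.differentiableAt)] at this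
      exact this
    set f : J1 → ℝ := fun z => Φ z 0
    have hexp : ∀ r, fderiv ℝ f (F k) ![0, 1, k 3, r, k 4] =
        (pd 1 f (F k) + k 3 * pd 2 f (F k) + k 4 * pd 4 f (F k)) + pd 3 f (F k) * r := by
      intro r
      rw [fderiv_eq_sum, Fin.sum_univ_five]
      simp
      ring
    simp only [hexp] at hzero ⊢
    obtain ⟨h1, h2⟩ := affine_eq_zero hzero
    exact ⟨h2, fun r => by rw [h1, h2]; ring⟩
  have hΦ0 : SmoothNear (fun z => Φ z 0) (toJ1 j₀) := smoothNear_pi.1 h.contact.smooth 0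
  obtain ⟨g, hg, hgΦ⟩ := exists_factor_toQ hΦ0
    (H.eventually_of_graph h.mem (hlin.mono fun k hk => hk.1))
  have hg' : SmoothNear g (toK j₀).toQ := hg
  obtain ⟨T, hT, hgT⟩ := exists_factor_time (k₀ := toK j₀) hg' (by
    filter_upwards [hlin, hFc.eventually (hF0 ▸ hgΦ)] with k hk hgk
    have := hk.2 0
    rw [hgk.2, fderiv_eq_sum, Fin.sum_univ_four] at this
    have hq : (F k).toQ = k.toQ := by ext i; fin_cases i <;> rfl
    rw [hq] at this
    rw [Dx, dx0, ← this]
    simp [J1.toQ, K.toQ]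
    ring)
  refine ⟨T, hT, ?_⟩
  filter_upwards [hgΦ, continuous_J1_toQ.continuousAt.eventually
    (show ∀ᶠ q in 𝓝 (toJ1 j₀).toQ, g q = T (q 0) from hgT)] with z h1 h2
  rw [h1.1, h2]
  rfl

/-! ### Contact transformations with `T = T(t)` -/

/-- If `T` depends on `t` only, then `∂_{u_t}` is mapped to a vector of the same direction: it spans
the radical of `omega` on the contact vectors with vanishing `dt`. -/
theorem IsContactAt.pd_ut_eq_zero {Φ : J1 → J1} {z : J1} (h : IsContactAt Φ z) {a : ℝ}
    (h0 : ∀ v, fderiv ℝ Φ z v 0 = a * v 0) :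
    pd 3 (fun y => Φ y 1) z = 0 ∧ pd 3 (fun y => Φ y 2) z = 0 ∧ pd 3 (fun y => Φ y 4) z = 0 := by
  obtain ⟨c, hc0, hθ, hω⟩ := exists_conformal_factor h.smooth h.contact
  have k3 : contactForm z (Pi.single 3 1) = 0 := by simp [contactForm]
  have k4 : contactForm z (Pi.single 4 1) = 0 := by simp [contactForm]
  have kx : contactForm z ![0, 1, z 4, 0, 0] = 0 := by simp [contactForm]
  have w34 := hω _ _ k3 k4
  have w3x := hω _ _ k3 kx
  have w4x := hω _ _ k4 kx
  have t3 := hθ (Pi.single 3 1)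
  rw [k3, mul_zero] at t3
  simp only [omega, h0] at w34 w3x w4x
  simp only [contactForm, h0] at t3
  have hpd : ∀ i, pd 3 (fun y => Φ y i) z = fderiv ℝ Φ z (Pi.single 3 1) i := fun i =>
    (fderiv_coord h.smooth.differentiableAt _ i).symm
  simp only [hpd]
  set p := fderiv ℝ Φ z (Pi.single 3 1)
  set q := fderiv ℝ Φ z (Pi.single 4 1)
  set r := fderiv ℝ Φ z ![0, 1, z 4, 0, 0]
  simp at w34 w3x w4x t3
  have e1 : c * p 1 = 0 := by linear_combination (-p 1) * w4x + q 1 * w3x - r 1 * w34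
  have e4 : c * p 4 = 0 := by linear_combination (-p 4) * w4x + q 4 * w3x - r 4 * w34
  have p1 : p 1 = 0 := (mul_eq_zero.1 e1).resolve_left hc0
  have p4 : p 4 = 0 := (mul_eq_zero.1 e4).resolve_left hc0
  refine ⟨p1, ?_, p4⟩
  rw [p1] at t3
  simpa using t3

/-- A contact transformation with `T = T(t)` has the explicit form. The transformed `u_x` is `V`:
both contact conditions hold with this value, and `F_x + F_u u_x` and `F_{u_x}` of `X` do not
vanish simultaneously because `omega` is preserved up to a nonzero factor. -/
theorem IsContactAt.exists_form {Φ : J1 → J1} {z₀ : J1} {T : ℝ → ℝ} (h : IsContactAt Φ z₀)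
    (hT : SmoothNear T (z₀ 0)) (hΦT : ∀ᶠ z in 𝓝 z₀, Φ z 0 = T (z 0)) :
    ∃ X U : Q → ℝ, SmoothNear X z₀.toQ ∧ SmoothNear U z₀.toQ ∧ deriv T (z₀ 0) ≠ 0 ∧
      (!![pd 1 X z₀.toQ, pd 2 X z₀.toQ, pd 3 X z₀.toQ;
          pd 1 U z₀.toQ, pd 2 U z₀.toQ, pd 3 U z₀.toQ]).rank = 2 ∧
      (∀ᶠ q in 𝓝 z₀.toQ, dx0 U q * pd 3 X q = dx0 X q * pd 3 U q) ∧
      (∀ᶠ z in 𝓝 z₀, Φ z = contactMap T X U z) ∧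
      ∀ v, fderiv ℝ Φ z₀ v 0 = deriv T (z₀ 0) * v 0 ∧
        fderiv ℝ Φ z₀ v 1 = fderiv ℝ X z₀.toQ v.toQ := by
  have hc0 : ContinuousAt (fun z : J1 => z 0) z₀ := (continuous_apply 0).continuousAt
  have hbase : ∀ᶠ z in 𝓝 z₀, IsContactAt Φ z ∧ Φ z 0 = T (z 0) ∧
      ∀ v, fderiv ℝ Φ z v 0 = deriv T (z 0) * v 0 := by
    filter_upwards [h.eventually, eventually_eventually_nhds.2 hΦT,
      hc0.eventually hT.eventually] with z h1 h2 h3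
    refine ⟨h1, h2.self_of_nhds, fun v => ?_⟩
    have hp : HasFDerivAt (fun y : J1 => y 0)
      (ContinuousLinearMap.proj (R := ℝ) (φ := fun _ : Fin 5 => ℝ) 0) z := hasFDerivAt_apply 0 z
    have hTd : HasDerivAt T (deriv T (z 0)) (z 0) := h3.differentiableAt.hasDerivAt
    rw [fderiv_coord h1.smooth.differentiableAt, Filter.EventuallyEq.fderiv_eq h2]
    change fderiv ℝ (T ∘ fun y : J1 => y 0) z v = _
    rw [(hTd.comp_hasFDerivAt z hp).fderiv]
    simp
  have hpd := hbase.mono fun z hz => hz.1.pd_ut_eq_zero hz.2.2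
  have hsm := smoothNear_pi.1 h.smooth
  obtain ⟨X, hX, hXΦ⟩ := exists_factor_toQ (hsm 1) (hpd.mono fun z hz => hz.1)
  obtain ⟨U, hU, hUΦ⟩ := exists_factor_toQ (hsm 2) (hpd.mono fun z hz => hz.2.1)
  obtain ⟨P, hP, hPΦ⟩ := exists_factor_toQ (hsm 4) (hpd.mono fun z hz => hz.2.2)
  -- the contact condition in coordinates
  have hmain : ∀ᶠ z in 𝓝 z₀, deriv T (z 0) ≠ 0 ∧
      pd 3 U z.toQ = P z.toQ * pd 3 X z.toQ ∧ dx0 U z.toQ = P z.toQ * dx0 X z.toQ ∧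
      (dx0 X z.toQ ≠ 0 ∨ pd 3 X z.toQ ≠ 0) ∧ pd 2 U z.toQ - P z.toQ * pd 2 X z.toQ ≠ 0 ∧
      Φ z 3 * deriv T (z 0) = (pd 2 U z.toQ - P z.toQ * pd 2 X z.toQ) * z 3 +
        (pd 0 U z.toQ - P z.toQ * pd 0 X z.toQ) := by
    filter_upwards [hbase, hXΦ, hUΦ, hPΦ] with z hz hXz hUz hPz
    obtain ⟨hcz, -, hz0⟩ := hz
    have hd := hcz.smooth.differentiableAt
    have h1 : ∀ v, fderiv ℝ Φ z v 1 = fderiv ℝ X z.toQ v.toQ := fun v => by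
      rw [fderiv_coord hd, hXz.2]
    have h2 : ∀ v, fderiv ℝ Φ z v 2 = fderiv ℝ U z.toQ v.toQ := fun v => by
      rw [fderiv_coord hd, hUz.2]
    have h4 : ∀ v, fderiv ℝ Φ z v 4 = fderiv ℝ P z.toQ v.toQ := fun v => by
      rw [fderiv_coord hd, hPz.2]
    obtain ⟨c, hc, hθ, hω⟩ := exists_conformal_factor hcz.smooth hcz.contact
    have hT0 : deriv T (z 0) ≠ 0 := by
      intro h0
      obtain ⟨v, hv⟩ := hcz.bijective.2 (Pi.single 0 1)
      have := hz0 v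
      rw [hv, h0] at this
      simp at this
    have t0 := hθ ![1, 0, 0, 0, 0]
    have tx := hθ ![0, 1, z 4, 0, 0]
    have t2 := hθ ![0, 0, 1, 0, 0]
    have t4 := hθ ![0, 0, 0, 0, 1]
    have wx := hω ![0, 0, 0, 0, 1] ![0, 1, z 4, 0, 0] (by simp [contactForm])
      (by simp [contactForm])
    simp only [contactForm, omega, hz0, h1, h2, h4, hPz.1, fderiv_eq_sum, Fin.sum_univ_four]
      at t0 tx t2 t4 wx
    simp [J1.toQ] at t0 tx t2 t4 wx
    simp only [dx0, J1.toQ]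
    simp
    refine ⟨hT0, by linear_combination t4, by linear_combination tx, ?_, ?_, ?_⟩
    · by_contra! hcon
      apply hc
      linear_combination -wx +
        pd 3 P ![z 0, z 1, z 2, z 4] * hcon.1 - (pd 1 P ![z 0, z 1, z 2, z 4] +
          z 4 * pd 2 P ![z 0, z 1, z 2, z 4]) * hcon.2
    · rw [t2]
      exact hc
    · linear_combination -t0 - z 3 * t2
  refine ⟨X, U, hX, hU, hmain.self_of_nhds.1, ?_, ?_, ?_, fun v => ⟨hbase.self_of_nhds.2.2 v, ?_⟩⟩
  · -- a linear relation between the rows has to be trivial, as the factor of the contact form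
    -- does not vanish
    obtain ⟨-, e3, ex, hne, hf, -⟩ := hmain.self_of_nhds
    have hli : LinearIndependent ℝ (!![pd 1 X z₀.toQ, pd 2 X z₀.toQ, pd 3 X z₀.toQ;
        pd 1 U z₀.toQ, pd 2 U z₀.toQ, pd 3 U z₀.toQ]).row := by
      rw [Fintype.linearIndependent_iff]
      intro g hg
      have r1 := congrFun hg 0
      have r2 := congrFun hg 1
      have r3 := congrFun hg 2
      simp [Fin.sum_univ_two, Matrix.row] at r1 r2 r3
      simp only [dx0] at ex hne
      have hsum : g 0 + g 1 * P z₀.toQ = 0 := by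
        rcases hne with hne | hne
        · refine (mul_eq_zero.1 ?_).resolve_right hne
          linear_combination r1 + z₀.toQ 3 * r2 - g 1 * ex
        · refine (mul_eq_zero.1 ?_).resolve_right hne
          linear_combination r3 - g 1 * e3
      have g1 : g 1 = 0 := by
        refine (mul_eq_zero.1 ?_).resolve_right hf
        linear_combination r2 - pd 2 X z₀.toQ * hsum
      have g0 : g 0 = 0 := by simpa [g1] using hsum
      intro i
      fin_cases i
      · exact g0
      · exact g1
    rw [hli.rank_matrix]
    simp
  · set ι : Q → J1 := fun q => ![q 0, q 1, q 2, z₀ 3, q 3] with hι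
    have hιc : Continuous ι := by fun_prop
    have hι0 : ι z₀.toQ = z₀ := by ext i; fin_cases i <;> rfl
    filter_upwards [hιc.continuousAt.eventually (by rw [hι0]; exact hmain)] with q hq
    have hq' : (ι q).toQ = q := by ext i; fin_cases i <;> rfl
    rw [hq'] at hq
    rw [hq.2.1, hq.2.2.1]
    ring
  · filter_upwards [hbase, hXΦ, hUΦ, hPΦ, hmain] with z hz hXz hUz hPz hm
    obtain ⟨hT0, e3, ex, hne, -, h3⟩ := hm
    have hV : V X U z.toQ = P z.toQ := by
      rw [V]
      split_ifs with hd
      · rw [ex, mul_div_cancel_right₀ _ hd]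
      · rw [e3, mul_div_cancel_right₀ _ (hne.resolve_left hd)]
    ext i
    fin_cases i
    · exact hz.2.1
    · exact hXz.1
    · exact hUz.1
    · change Φ z 3 = newRhs T X U z.toQ (z 3)
      rw [newRhs, hV]
      change _ = _ / deriv T (z 0) * _ + _ / deriv T (z 0)
      field_simp
      linear_combination h3
    · exact hPz.1.trans hV.symm
  · rw [fderiv_coord h.smooth.differentiableAt, hXΦ.self_of_nhds.2]

/-! ### The form of admissible transformations and of the equivalence group -/

theorem IsAdmissible.exists_form {H H' : EvolEq} {Φ : J1 → J1} {j₀ : J2}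
    (h : IsAdmissible H H' Φ j₀) :
    ∃ (T : ℝ → ℝ) (X U : Q → ℝ), IsContactData T X U (toK j₀) ∧
      (∀ᶠ z in 𝓝 (toJ1 j₀), Φ z = contactMap T X U z) ∧
      ∀ᶠ k in 𝓝 (toK j₀), mapK T X U k ∈ H'.dom ∧
        H'.rhs (mapK T X U k) = newRhs T X U k.toQ (H.rhs k) := by
  obtain ⟨T, hT, hΦT⟩ := h.exists_time
  obtain ⟨X, U, hX, hU, hT0, hrank, hcontact, hform, hder⟩ := h.contact.exists_form hT hΦT
  have hdata : IsContactData T X U (toK j₀) := by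
    refine ⟨hT, hX, hU, hT0, hrank, hcontact, fun h0 => ?_⟩
    obtain ⟨j', hj'⟩ := h.defined
    refine (isProlongation_iff.1 hj').2.1 ?_
    rw [totJac, (hder _).1, (hder _).1, (hder (totX j₀)).2, fderiv_totX, h0]
    simp [totX]
  refine ⟨T, X, U, hdata, hform, ?_⟩
  obtain ⟨hdom, hval⟩ := h.mem
  set J : K → J2 := fun k => ![k 0, k 1, k 2, H.rhs k, k 3, j₀ 5, j₀ 6, k 4] with hJ
  have hJ0 : J (toK j₀) = j₀ := by
    ext i
    fin_cases i
    · rfl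
    · rfl
    · rfl
    · exact hval.symm
    · rfl
    · rfl
    · rfl
    · rfl
  have hJc : ContinuousAt J (toK j₀) := by
    refine continuousAt_pi.2 fun i => ?_
    fin_cases i
    · exact (continuous_apply 0).continuousAt
    · exact (continuous_apply 1).continuousAt
    · exact (continuous_apply 2).continuousAt
    · exact (H.contDiffAt hdom).continuousAt
    · exact (continuous_apply 3).continuousAt
    · exact continuousAt_const
    · exact continuousAt_const
    · exact (continuous_apply 4).continuousAt
  have hev := hJc.eventually (p := fun j => IsAdmissibleNear H H' Φ j ∧
      ∀ᶠ z in 𝓝 (toJ1 j), Φ z = contactMap T X U z) (by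
    rw [hJ0]
    exact h.eventually.and
      (continuous_toJ1.continuousAt.eventually (eventually_eventually_nhds.2 hform)))
  filter_upwards [hev, hdata.eventually, H.isOpen_dom.mem_nhds hdom] with k hk hreg hkd
  have hKJ : toK (J k) = k := by ext i; fin_cases i <;> rfl
  have hr : IsRegularAt T X U (toK (J k)).toQ := by rw [hKJ]; exact hreg.1
  obtain ⟨j', hj', -⟩ := hr.existsUnique_isProlongation (by rw [hKJ]; exact hreg.2)
  have hmem : J k ∈ H.manifold := by
    change toK (J k) ∈ H.dom ∧ H.rhs k = H.rhs (toK (J k))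
    rw [hKJ]
    exact ⟨hkd, rfl⟩
  obtain ⟨h1, h2⟩ := (hk.1.maps j' (hj'.congr hk.2)).1 hmem
  have h3 : contactMap T X U (toJ1 (J k)) 3 = j' 3 := congrFun hj'.1 3
  rw [hr.toK_of_isProlongation hj', hKJ] at h1 h2
  exact ⟨h1, by rw [← h2, ← h3]; rfl⟩

/-- The equation `u_t = h + u_xx - a`. Equations of this form pass through any given jet with any
given value `h` of the arbitrary element. -/
def heatEq (h a : ℝ) : EvolEq where
  dom := Set.univ
  isOpen_dom := isOpen_univ
  rhs k := h + (k 4 - a)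
  smooth := (contDiff_const.add ((contDiff_apply ℝ ℝ (4 : Fin 5)).sub contDiff_const)).contDiffOn
  nondeg k _ := by
    have : HasFDerivAt (fun k : K => h + (k 4 - a))
        (ContinuousLinearMap.proj (R := ℝ) (φ := fun _ : Fin 5 => ℝ) 4) k :=
      ((hasFDerivAt_apply (4 : Fin 5) k).sub_const a).const_add h
    rw [pd, this.fderiv]
    simp

theorem heatEq_onGraph (j : J2) (h : ℝ) : (heatEq h (j 7)).OnGraph j h := by
  refine ⟨Set.mem_univ _, ?_⟩
  change h = h + (j 7 - j 7)
  ring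

theorem IsEquivalence.exists_form {Φ : J1 → J1} {η : J2 × ℝ → ℝ} {j₀ : J2}
    (h : IsEquivalence Φ η j₀) :
    ∃ (T : ℝ → ℝ) (X U : Q → ℝ), IsContactData T X U (toK j₀) ∧
      (∀ᶠ z in 𝓝 (toJ1 j₀), Φ z = contactMap T X U z) ∧
      ∀ᶠ y in 𝓝 (j₀, j₀ 3), η y = newRhs T X U (K.toQ (toK y.1)) y.2 := by
  obtain ⟨D, hD, hmap, -⟩ := h.class_onto
  obtain ⟨T, X, U, hdata, hform⟩ : ∃ (T : ℝ → ℝ) (X U : Q → ℝ), IsContactData T X U (toK j₀) ∧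
      ∀ᶠ z in 𝓝 (toJ1 j₀), Φ z = contactMap T X U z := by
    obtain ⟨H', hH'⟩ := hmap (heatEq (j₀ 3) (j₀ 7))
    have hc : Continuous (fun j : J2 => (j, j 3)) := by fun_prop
    have hadm : IsAdmissible (heatEq (j₀ 3) (j₀ 7)) H' Φ j₀ :=
      ⟨heatEq_onGraph _ _, h.contact, h.defined,
        (hc.tendsto j₀ |>.eventually hD).mono fun j hj j' hj' => hH'.2 j j' hj hj'⟩
    obtain ⟨T, X, U, h1, h2, -⟩ := hadm.exists_form
    exact ⟨T, X, U, h1, h2⟩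
  refine ⟨T, X, U, hdata, hform, ?_⟩
  -- the value of `η` at `(j, s)` is found by means of an equation whose graph contains `(j, s)`;
  -- the jet `m (j, s)` belongs to its manifold
  set m : J2 × ℝ → J2 := fun y => ![y.1 0, y.1 1, y.1 2, y.2, y.1 4, y.1 5, y.1 6, y.1 7] with hm
  have hmc : Continuous m := by fun_prop
  have hm0 : m (j₀, j₀ 3) = j₀ := by ext i; fin_cases i <;> rfl
  have hmD : ∀ᶠ y in 𝓝 (j₀, j₀ 3), (m y, y.2) ∈ D := by
    have : Continuous (fun y => (m y, y.2)) := hmc.prodMk continuous_snd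
    exact this.continuousAt.eventually (by
      change ∀ᶠ y in 𝓝 (m (j₀, j₀ 3), j₀ 3), y ∈ D
      rw [hm0]
      exact hD)
  have hfe := eventually_eventually_nhds.2 hform
  filter_upwards [hD, hmD,
    (continuous_toK.comp continuous_fst).continuousAt.eventually hdata.eventually,
    (continuous_toJ1.comp continuous_fst).continuousAt.eventually hfe,
    (continuous_toJ1.comp hmc).continuousAt.eventually (by
      rw [Function.comp_apply, hm0]; exact hfe)] with y hyD hymD hreg hΦ1 hΦ2
  have hmK : toK (m y) = toK y.1 := by ext i; fin_cases i <;> rfl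
  have hr : IsRegularAt T X U (toK y.1).toQ := hreg.1
  have hr' : IsRegularAt T X U (toK (m y)).toQ := by rw [hmK]; exact hr
  obtain ⟨i, hi, -⟩ := hr.existsUnique_isProlongation hreg.2
  obtain ⟨i', hi', -⟩ := hr'.existsUnique_isProlongation (by rw [hmK]; exact hreg.2)
  obtain ⟨H', hH'⟩ := hmap (heatEq y.2 (y.1 7))
  have h1 := (hH'.1 y.1 y.2 i hyD (hi.congr hΦ1)).1 (heatEq_onGraph _ _)
  have h2 := (hH'.2 (m y) i' hymD (hi'.congr hΦ2)).1 (heatEq_onGraph (m y) y.2)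
  have h3 : contactMap T X U (toJ1 (m y)) 3 = i' 3 := congrFun hi'.1 3
  calc η y = H'.rhs (toK i) := h1.2
    _ = H'.rhs (toK i') := by
      rw [hr.toK_of_isProlongation hi, hr'.toK_of_isProlongation hi', hmK]
    _ = i' 3 := h2.2.symm
    _ = newRhs T X U (K.toQ (toK y.1)) y.2 := h3.symm

theorem contactNormalized : ContactNormalized := by
  intro H H' Φ j₀ h
  obtain ⟨T, X, U, hdata, hform, hrhs⟩ := h.exists_form
  have hη : ∀ᶠ y in 𝓝 (j₀, j₀ 3), (fun y : J2 × ℝ => newRhs T X U (K.toQ (toK y.1)) y.2) y =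
      newRhs T X U (K.toQ (toK y.1)) y.2 := Filter.Eventually.of_forall fun y => rfl
  refine ⟨_, hdata.isEquivalence hform hη, ?_⟩
  obtain ⟨D, hDn, hD⟩ := exists_mem_nhds_formula
    (hdata.eventually.and (hrhs.and (H.isOpen_dom.mem_nhds h.mem.1))) hform hη
  exact ⟨D, hDn, transforms_of_formula (fun k hk => hk.1.1) hD fun k hk =>
    ⟨iff_of_true hk.2.1.1 hk.2.2, fun _ => hk.2.1.2⟩⟩

end EvolContact

theorem proposition1 :
    -- the class is normalized with respect to contact transformations
    EvolContact.ContactNormalized ∧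
    -- the contact equivalence group
    (∀ (Φ : EvolContact.J1 → EvolContact.J1) (η : EvolContact.J2 × ℝ → ℝ) (j₀ : EvolContact.J2),
      EvolContact.IsEquivalence Φ η j₀ ↔
        ∃ (T : ℝ → ℝ) (X U : EvolContact.Q → ℝ),
          EvolContact.IsContactData T X U (EvolContact.toK j₀) ∧
          (∀ᶠ z in nhds (EvolContact.toJ1 j₀), Φ z = EvolContact.contactMap T X U z) ∧
          (∀ᶠ y in nhds (j₀, j₀ 3),
            η y = EvolContact.newRhs T X U (EvolContact.K.toQ (EvolContact.toK y.1)) y.2)) ∧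
    -- the prolongation of these transformations to `u_x` and `u_xx`
    (∀ (T : ℝ → ℝ) (X U : EvolContact.Q → ℝ) (j₀ : EvolContact.J2),
      EvolContact.IsContactData T X U (EvolContact.toK j₀) →
        ∀ᶠ j in nhds j₀,
          (∃! j' : EvolContact.J2,
            EvolContact.IsProlongation (EvolContact.contactMap T X U) j j') ∧
          ∀ j' : EvolContact.J2,
            EvolContact.IsProlongation (EvolContact.contactMap T X U) j j' →
              EvolContact.toK j' = EvolContact.mapK T X U (EvolContact.toK j)) ∧
    -- the form of all admissible transformations and the transformed right-hand side
    (∀ (H H' : EvolContact.EvolEq) (Φ : EvolContact.J1 → EvolContact.J1) (j₀ : EvolContact.J2),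
      EvolContact.IsAdmissible H H' Φ j₀ →
        ∃ (T : ℝ → ℝ) (X U : EvolContact.Q → ℝ),
          EvolContact.IsContactData T X U (EvolContact.toK j₀) ∧
          (∀ᶠ z in nhds (EvolContact.toJ1 j₀), Φ z = EvolContact.contactMap T X U z) ∧
          (∀ᶠ k in nhds (EvolContact.toK j₀),
            EvolContact.mapK T X U k ∈ H'.dom ∧
            H'.rhs (EvolContact.mapK T X U k) =
              EvolContact.newRhs T X U (EvolContact.K.toQ k) (H.rhs k))) := by
  refine ⟨EvolContact.contactNormalized, fun Φ η j₀ => ⟨fun h => h.exists_form, ?_⟩,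
    fun T X U j₀ h => ?_, fun H H' Φ j₀ h => h.exists_form⟩
  · rintro ⟨T, X, U, h, hΦ, hη⟩
    exact h.isEquivalence hΦ hη
  · filter_upwards [EvolContact.continuous_toK.continuousAt.eventually h.eventually] with j hj
    exact ⟨hj.1.existsUnique_isProlongation hj.2, fun j' hj' => hj.1.toK_of_isProlongation hj'⟩
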